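/- \textbf{Theorem 2.} All logarithms are to base $2$. Let $\mathcal U$ be a finite group of order $J$, written additively, let $\mathcal V=\mathcal U$ (so $M:=|\mathcal V|=J$), and let $\varrho:\mathcal U\to[0,\infty)$ define the difference distortion $\rho(u,v)=\varrho(v-u)$. For real $D\ge\min\varrho$ let $\Phi(D)$ be the maximum of the entropy $H(W)$ over all $\mathcal U$-valued random variables $W$ with $\mathbf E\varrho(W)\le D$, and let $$\Psi(x)=\begin{cases}0,&x<0,\\ \Phi^{-1}(x):=\inf\{D\ge\min\varrho:\ \Phi(D)\ge x\},&x\ge0,\end{cases}$$ with $\inf\emptyset=+\infty$. Let $\mathcal X,\mathcal Y$ be finite alphabets of sizes $K,L$ and let $P(y|x)$ be a discrete memoryless channel from $\mathcal X$ to $\mathcal Y$ with capacity $C=\max_{P_X}I(X;Y)$. Let $\ell\ge1$ and $n\ge2$ with $\ell\mid n$. A deterministic sequence $u^n\in\mathcal U^n$ is mapped by an arbitrary encoder into $x^n\in\mathcal X^n$, which is sent through the channel; its output is $Y^n$. A decoder with a finite set $\mathcal Z$ of $s$ states, a modulo-$\ell$ counter and delay $d$ has an initial state $z_1\in\mathcal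 Z$ and functions $f_\tau:\mathcal Z\times\mathcal Y\to\mathcal V$, $g_\tau:\mathcal Z\times\mathcal Y\to\mathcal Z$ ($0\le\tau<\ell$), and works by $$V_{t-d}=f_{t\bmod\ell}(z_t,Y_t)\ (d+1\le t\le n),\qquad z_{t+1}=g_{t\bmod \ell}(z_t,Y_t)\ (t\ge1);$$ the remaining symbols $V_t$, $n-d<t\le n$, are arbitrary symbols of $\mathcal V$ (possibly depending on $Y^n$). Let $c(u^n)$ be the number of phrases of the Lempel--Ziv incremental parsing of $u^n$ (each phrase is the shortest string that differs from all earlier phrases; a last, incomplete phrase counts). Then $$\frac1n\sum_{t=1}^n\mathbf E\{\varrho(V_t-u_t)\}\ \ge\ \Psi\!\left(\frac{c(u^n)\log c(u^n)}{n}-C-\frac{2\log s+d\log M}{\ell}-\delta_2(\ell,n)\right),$$ where $$\delta_2(\ell,n)=\delta_1(\ell,n)+\frac{2\ell(1+\log J)^2}{(1-\epsilon_n)\log n}+\frac{2\ell J^{2\ell}\log J}{n}+\frac1\ell,$$ $$\delta_1(\ell,n)=\frac{(JK)^\ell\log L}{\sqrt n}+\frac{(JKL)^\ell\log e}{2n}+o\!\left(\frac1{\sqrt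 n}\right).$$ Here $(\epsilon_n)$ is a sequence in $(0,1)$ that tends to $0$ and depends only on $J$, and the $o(1/\sqrt n)$ term ($n\to\infty$) depends only on $J,K,L,\ell$ and $n$; both are the same for all $u^n$, encoders, channels, decoders, delays, numbers of states and distortion functions $\varrho$. -/

import Mathlib

namespace SemiDet

noncomputable section

/-- Shannon entropy, in bits, of a probability vector on a finite alphabet. -/
def entropy {A : Type*} [Fintype A] (p : A → ℝ) : ℝ :=
  -∑ a, p a * Real.logb 2 (p a)

/-- A discrete memoryless channel is given by its single-letter transition probabilities
`P x y = P(y|x)`; every row is a probability vector. -/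
def IsChannel {X Y : Type*} [Fintype Y] (P : X → Y → ℝ) : Prop :=
  ∀ x, P x ∈ stdSimplex ℝ Y

/-- Mutual information `I(X;Y) = H(Y) - H(Y|X)` for the input law `p` and the channel `P`. -/
def mutualInfo {X Y : Type*} [Fintype X] [Fintype Y] (p : X → ℝ) (P : X → Y → ℝ) : ℝ :=
  entropy (fun y => ∑ x, p x * P x y) - ∑ x, p x * entropy (P x)

/-- Channel capacity: the maximum of `I(X;Y)` over all input laws. -/
def capacity {X Y : Type*} [Fintype X] [Fintype Y] (P : X → Y → ℝ) : ℝ :=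
  sSup ((fun p => mutualInfo p P) '' stdSimplex ℝ X)

/-- Expectation of `F(Y^n)`, where `Y^n` is the output of the memoryless channel `P` fed by the
deterministic input `x^n`. -/
def expect {X Y : Type*} [Fintype Y] {n : ℕ} (P : X → Y → ℝ) (x : Fin n → X)
    (F : (Fin n → Y) → ℝ) : ℝ :=
  ∑ y : Fin n → Y, (∏ t, P (x t) (y t)) * F y

/-- A finite-state decoder with state set `Z`, initial state `z_1 = init`, and output and
next-state functions `f_τ = out τ`, `g_τ = next τ`. The index `τ` is the value of a counter. -/
structure Decoder (Z Y V : Type*) where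
  init : Z
  out : ℕ → Z → Y → V
  next : ℕ → Z → Y → Z

/-- `D.state ℓ y i` is the state `z_{i+1}` when the counter is modulo `ℓ` and the channel
output is `y^n` (entry `i` of `y` is `y_{i+1}`): `z_1 = init` and
`z_{t+1} = g_{t mod ℓ}(z_t, y_t)` for `1 ≤ t ≤ n`. Later states are never used. -/
def Decoder.state {Z Y V : Type*} (D : Decoder Z Y V) (ℓ : ℕ) {n : ℕ} (y : Fin n → Y) : ℕ → Z
  | 0 => D.init
  | i + 1 =>
    if h : i < n then D.next ((i + 1) % ℓ) (D.state ℓ y i) (y ⟨i, h⟩) else D.state ℓ y i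

/-- The reconstruction `v^n` with delay `d` (entry `j` is `v_{j+1}`):
`v_{t-d} = f_{t mod ℓ}(z_t, y_t)` for `d + 1 ≤ t ≤ n`. The last `d` symbols, which are not yet
decoded at time `n`, are the arbitrary symbols given by `tail`. -/
def Decoder.recon {Z Y V : Type*} (D : Decoder Z Y V) (ℓ d : ℕ) {n : ℕ}
    (tail : (Fin n → Y) → Fin n → V) (y : Fin n → Y) (j : Fin n) : V :=
  if h : (j : ℕ) + d < n then
    D.out ((j + d + 1) % ℓ) (D.state ℓ y (j + d)) (y ⟨j + d, h⟩)
  else tail y j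

/-- `Φ(D)`: the maximum entropy of a random variable `W` with `E ϱ(W) ≤ D`. -/
def maxEntropy {U : Type*} [Fintype U] (ϱ : U → ℝ) (D : ℝ) : ℝ :=
  sSup (entropy '' {p | p ∈ stdSimplex ℝ U ∧ ∑ w, p w * ϱ w ≤ D})

/-- The set of `D` in the domain of `Φ` (the constraint `E ϱ(W) ≤ D` is feasible) with
`Φ(D) ≥ x`. -/
def levelSet {U : Type*} [Fintype U] (ϱ : U → ℝ) (x : ℝ) : Set ℝ :=
  {D | (∃ p ∈ stdSimplex ℝ U, ∑ w, p w * ϱ w ≤ D) ∧ x ≤ maxEntropy ϱ D}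

/-- `Ψ(x) = 0` for `x < 0` and `Ψ(x) = Φ⁻¹(x)` for `x ≥ 0`, where
`Φ⁻¹(x) = inf {D | Φ(D) ≥ x}`. The value is `⊤` when `x` exceeds every value of `Φ`. -/
def psi {U : Type*} [Fintype U] (ϱ : U → ℝ) (x : ℝ) : EReal :=
  if x < 0 then 0 else sInf ((fun D : ℝ => (D : EReal)) '' levelSet ϱ x)

/-- `δ₁(ℓ,n)`, where `r` is the value at `n` of the `o(1/√n)` term. -/
def delta1 (J K L ℓ n : ℕ) (r : ℝ) : ℝ :=
  ((J : ℝ) * K) ^ ℓ * Real.logb 2 L / √(n : ℝ)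
    + ((J : ℝ) * K * L) ^ ℓ * Real.logb 2 (Real.exp 1) / (2 * n) + r

/-- `δ₂(ℓ,n)`, where `r` is the value at `n` of the `o(1/√n)` term of `δ₁`, and `ε` is `ε_n`. -/
def delta2 (J K L ℓ n : ℕ) (r ε : ℝ) : ℝ :=
  delta1 J K L ℓ n r
    + 2 * ℓ * (1 + Real.logb 2 J) ^ 2 / ((1 - ε) * Real.logb 2 n)
    + 2 * ℓ * (J : ℝ) ^ (2 * ℓ) * Real.logb 2 J / n
    + 1 / ℓ

end

/-- Incremental parsing, with `done` the list of phrases already completed, `cur` the part of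
the current phrase read so far and the last argument the unread rest. A phrase is completed as
soon as it differs from all earlier phrases. The last phrase may remain incomplete; it is kept
as a phrase if it is nonempty. -/
def lzParseAux {A : Type*} [DecidableEq A] :
    List (List A) → List A → List A → List (List A)
  | done, cur, [] => if cur = [] then done else done ++ [cur]
  | done, cur, a :: rest =>
    if cur ++ [a] ∈ done then lzParseAux done (cur ++ [a]) rest
    else lzParseAux (done ++ [cur ++ [a]]) [] rest

/-- The phrases of the Lempel–Ziv incremental parsing. -/
def lzParse {A : Type*} [DecidableEq A] (w : List A) : List (List A) :=
  lzParseAux [] [] w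

/-- `c(u^n)`: the number of phrases of the incremental parsing of `u^n`. -/
def lzCount {A : Type*} [DecidableEq A] {n : ℕ} (u : Fin n → A) : ℕ :=
  (lzParse (List.ofFn u)).length

end SemiDet

/-! Cut `u` into `k = n / ℓ` blocks and choose one uniformly at random. This makes the source block
U random although `u` is fixed. Let I be the chosen index, and let Y, V and W = V - U be the blocks
of channel outputs, reconstructions and errors. Two bounds on H(U) are compared.

Upper bound (`rvEntropy_source_block_le`). Since (V, W) determines U, H(U|V) ≤ H(W). Since V is a
function of the state at the start of the block, of Y and of at most d undecoded symbols, I(U;V) ≤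
I(U;Y) + log s + d log J. As U is a function of I and the channel is memoryless, I(U;Y) ≤ I(I;Y) ≤
ℓC. Averaging the laws of the letters of W gives one law q with the distortion of the scheme and
H(W) ≤ ℓ H(q) (`exists_error_law`). A single log s suffices here.

Lower bound (`lzCount_mul_log_le_entropy`). An automaton that tracks the current block multiplies
conditional probabilities under the empirical block law, with an extra 1/2 per block. Its total
weight on `u` is 2^(-kH(U)-k). From a fixed state the weights of all words have a bounded sum, so
distinctness of the phrases bounds the sum of the phrase weights by 2ℓ²J^ℓ + 1. Jensen's inequality
then gives c log c ≤ kH(U) + k + c log(2ℓ²J^ℓ + 1).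

After division by n, the term k becomes 1/ℓ, and c = O(n / log n) with an explicit constant places
the last term inside δ₂ for large n. Hence H(q) is at least the argument of Ψ. For the finitely many
small n the o(1/√n) term makes that argument negative. -/

namespace SemiDet

/-! ### Entropy of random variables on a finite weighted space -/

section RandomVariables

variable {Ω A B C : Type*} [Fintype Ω]

open scoped Classical in
/-- The probability of the event `f = a` under the weights `μ`. -/
noncomputable def mass (μ : Ω → ℝ) (f : Ω → A) (a : A) : ℝ :=
  ∑ ω with f ω = a, μ ω

/-- The entropy, in bits, of the random variable `f` under the weights `μ`. -/
noncomputable def rvEntropy (μ : Ω → ℝ) (f : Ω → A) : ℝ :=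
  -∑ ω, μ ω * Real.logb 2 (mass μ f (f ω))

lemma mass_nonneg {μ : Ω → ℝ} (hμ : ∀ ω, 0 ≤ μ ω) (f : Ω → A) (a : A) : 0 ≤ mass μ f a :=
  Finset.sum_nonneg fun ω _ => hμ ω

lemma le_mass {μ : Ω → ℝ} (hμ : ∀ ω, 0 ≤ μ ω) (f : Ω → A) (ω : Ω) : μ ω ≤ mass μ f (f ω) := by
  classical
  exact Finset.single_le_sum (f := μ) (fun ω _ => hμ ω) (by simp)

lemma sum_mass_mul [Fintype A] (μ : Ω → ℝ) (f : Ω → A) (F : A → ℝ) :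
    ∑ a, mass μ f a * F a = ∑ ω, μ ω * F (f ω) := by
  classical
  rw [← Finset.sum_fiberwise (s := Finset.univ) (g := f)]
  refine Finset.sum_congr rfl fun a _ => ?_
  rw [mass, Finset.sum_mul]
  refine Finset.sum_congr rfl fun ω hω => ?_
  rw [(Finset.mem_filter.1 hω).2]

lemma mass_mem_stdSimplex [Fintype A] {μ : Ω → ℝ} (hμ : μ ∈ stdSimplex ℝ Ω) (f : Ω → A) :
    mass μ f ∈ stdSimplex ℝ A := by
  refine ⟨mass_nonneg hμ.1 f, ?_⟩
  have := sum_mass_mul μ f (fun _ => 1)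
  simpa [hμ.2] using this

lemma entropy_mass [Fintype A] (μ : Ω → ℝ) (f : Ω → A) :
    entropy (mass μ f) = rvEntropy μ f := by
  rw [entropy, rvEntropy, sum_mass_mul μ f (fun a => Real.logb 2 (mass μ f a))]

lemma sum_mass_pair [Fintype A] (μ : Ω → ℝ) (f : Ω → A) (h : Ω → C) (c : C) :
    ∑ a, mass μ (fun ω => (f ω, h ω)) (a, c) = mass μ h c := by
  classical
  unfold mass
  rw [← Finset.sum_fiberwise (s := Finset.univ.filter fun ω => h ω = c) (g := f)]
  refine Finset.sum_congr rfl fun a _ => Finset.sum_congr ?_ fun _ _ => rfl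
  ext ω
  simp [and_comm]

/-- Gibbs' inequality. -/
lemma rvEntropy_le_of_subprob [Fintype A] {μ : Ω → ℝ} (hμ : μ ∈ stdSimplex ℝ Ω) (f : Ω → A)
    (g : A → ℝ) (hg : ∀ a, 0 ≤ g a) (hsum : ∑ a, g a ≤ 1) (hpos : ∀ ω, 0 < μ ω → 0 < g (f ω)) :
    rvEntropy μ f ≤ -∑ ω, μ ω * Real.logb 2 (g (f ω)) := by
  have hterm : ∀ ω, μ ω * (Real.log (g (f ω)) - Real.log (mass μ f (f ω)))
      ≤ μ ω * (g (f ω) / mass μ f (f ω)) - μ ω := by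
    intro ω
    rcases (hμ.1 ω).eq_or_lt with h0 | h0
    · simp [← h0]
    · have hm : 0 < mass μ f (f ω) := h0.trans_le (le_mass hμ.1 f ω)
      have hg' := hpos ω h0
      rw [← Real.log_div hg'.ne' hm.ne']
      have := Real.log_le_sub_one_of_pos (div_pos hg' hm)
      nlinarith
  have hq : ∑ ω, μ ω * (g (f ω) / mass μ f (f ω)) ≤ 1 := by
    rw [← sum_mass_mul μ f (fun a => g a / mass μ f a)]
    refine le_trans (Finset.sum_le_sum fun a _ => ?_) hsum
    rcases (mass_nonneg hμ.1 f a).eq_or_lt with h0 | h0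
    · rw [← h0]; simpa using hg a
    · rw [mul_div_cancel₀ _ h0.ne']
  have htot := Finset.sum_le_sum fun ω (_ : ω ∈ Finset.univ) => hterm ω
  rw [Finset.sum_sub_distrib, hμ.2] at htot
  have h2 : 0 < Real.log 2 := Real.log_pos (by norm_num)
  have hle : (∑ ω, μ ω * (Real.log (g (f ω)) - Real.log (mass μ f (f ω)))) / Real.log 2 ≤ 0 :=
    div_nonpos_of_nonpos_of_nonneg (by linarith) h2.le
  have heq : (∑ ω, μ ω * (Real.log (g (f ω)) - Real.log (mass μ f (f ω)))) / Real.log 2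
      = ∑ ω, μ ω * Real.logb 2 (g (f ω)) - ∑ ω, μ ω * Real.logb 2 (mass μ f (f ω)) := by
    rw [← Finset.sum_sub_distrib, Finset.sum_div]
    refine Finset.sum_congr rfl fun ω _ => ?_
    simp only [Real.logb]
    ring
  rw [rvEntropy]
  linarith

lemma rvEntropy_le_log_card [Fintype A] {μ : Ω → ℝ} (hμ : μ ∈ stdSimplex ℝ Ω) (f : Ω → A) :
    rvEntropy μ f ≤ Real.logb 2 (Fintype.card A) := by
  have hne : Nonempty Ω := by
    by_contra h
    rw [not_nonempty_iff] at h
    simpa using hμ.2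
  have hA : 0 < (Fintype.card A : ℝ) := by
    have : Nonempty A := hne.map f
    exact_mod_cast Fintype.card_pos
  refine (rvEntropy_le_of_subprob hμ f (fun _ => (Fintype.card A : ℝ)⁻¹) (fun _ => by positivity)
    (by simp [hA.ne']) (fun _ _ => by positivity)).trans_eq ?_
  rw [← Finset.sum_mul, hμ.2, Real.logb_inv]
  ring

/-- A function of a random variable has at most its entropy. -/
lemma rvEntropy_le_of_kernel {μ : Ω → ℝ} (hμ : ∀ ω, 0 ≤ μ ω) (f : Ω → A) (g : Ω → B)
    (hfg : ∀ ω ω', f ω = f ω' → g ω = g ω') : rvEntropy μ g ≤ rvEntropy μ f := by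
  classical
  refine neg_le_neg (Finset.sum_le_sum fun ω _ => ?_)
  rcases (hμ ω).eq_or_lt with h0 | h0
  · simp [← h0]
  · refine mul_le_mul_of_nonneg_left ?_ (hμ ω)
    refine Real.logb_le_logb_of_le (by norm_num) (h0.trans_le (le_mass hμ f ω)) ?_
    refine Finset.sum_le_sum_of_subset_of_nonneg ?_ fun ω _ _ => hμ ω
    intro ω' hω'
    simp only [Finset.mem_filter, Finset.mem_univ, true_and] at hω' ⊢
    exact hfg _ _ hω'

/-- Gibbs' inequality against the law that makes `f` and `g` conditionally independent given `h`. -/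
lemma rvEntropy_submodular [Fintype A] [Fintype B] [Fintype C] {μ : Ω → ℝ}
    (hμ : μ ∈ stdSimplex ℝ Ω) (f : Ω → A) (g : Ω → B) (h : Ω → C) :
    rvEntropy μ (fun ω => (f ω, g ω, h ω)) + rvEntropy μ h
      ≤ rvEntropy μ (fun ω => (f ω, h ω)) + rvEntropy μ (fun ω => (g ω, h ω)) := by
  have key := rvEntropy_le_of_subprob hμ (fun ω => (f ω, g ω, h ω))
    (fun p => mass μ (fun ω => (f ω, h ω)) (p.1, p.2.2) * mass μ (fun ω => (g ω, h ω)) p.2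
      / mass μ h p.2.2)
    (fun p => div_nonneg (mul_nonneg (mass_nonneg hμ.1 _ _) (mass_nonneg hμ.1 _ _))
      (mass_nonneg hμ.1 _ _)) ?_ ?_
  · have heq : ∀ ω, μ ω * Real.logb 2 (mass μ (fun ω => (f ω, h ω)) (f ω, h ω)
          * mass μ (fun ω => (g ω, h ω)) (g ω, h ω) / mass μ h (h ω))
        = μ ω * Real.logb 2 (mass μ (fun ω => (f ω, h ω)) (f ω, h ω))
          + μ ω * Real.logb 2 (mass μ (fun ω => (g ω, h ω)) (g ω, h ω))
          - μ ω * Real.logb 2 (mass μ h (h ω)) := by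
      intro ω
      rcases (hμ.1 ω).eq_or_lt with h0 | h0
      · simp [← h0]
      · have h1 := h0.trans_le (le_mass hμ.1 (fun ω => (f ω, h ω)) ω)
        have h2 := h0.trans_le (le_mass hμ.1 (fun ω => (g ω, h ω)) ω)
        have h3 := h0.trans_le (le_mass hμ.1 h ω)
        rw [Real.logb_div (mul_pos h1 h2).ne' h3.ne', Real.logb_mul h1.ne' h2.ne']
        ring
    simp only [heq] at key
    rw [Finset.sum_sub_distrib, Finset.sum_add_distrib] at key
    simp only [rvEntropy] at key ⊢
    linarith
  · rw [Fintype.sum_prod_type]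
    simp only [Fintype.sum_prod_type]
    have : ∀ c, ∑ a, ∑ b, mass μ (fun ω => (f ω, h ω)) (a, c)
        * mass μ (fun ω => (g ω, h ω)) (b, c) / mass μ h c = mass μ h c := by
      intro c
      simp only [← Finset.sum_div, ← Finset.mul_sum, ← Finset.sum_mul, sum_mass_pair]
      exact mul_self_div_self _
    rw [Finset.sum_congr rfl fun a _ => Finset.sum_comm, Finset.sum_comm,
      Finset.sum_congr rfl fun c _ => this c]
    exact (mass_mem_stdSimplex hμ h).2.le
  · intro ω h0
    exact div_pos (mul_pos (h0.trans_le (le_mass hμ.1 (fun ω => (f ω, h ω)) ω))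
      (h0.trans_le (le_mass hμ.1 (fun ω => (g ω, h ω)) ω))) (h0.trans_le (le_mass hμ.1 h ω))

lemma rvEntropy_unit {μ : Ω → ℝ} (hμ : μ ∈ stdSimplex ℝ Ω) :
    rvEntropy μ (fun _ => ()) = 0 := by
  have := hμ.2
  simp [rvEntropy, mass, this]

lemma rvEntropy_pair_le [Fintype A] [Fintype B] {μ : Ω → ℝ} (hμ : μ ∈ stdSimplex ℝ Ω)
    (f : Ω → A) (g : Ω → B) :
    rvEntropy μ (fun ω => (f ω, g ω)) ≤ rvEntropy μ f + rvEntropy μ g := by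
  have h1 := rvEntropy_submodular hμ f g (fun _ => ())
  have h2 : rvEntropy μ (fun ω => (f ω, g ω)) ≤ rvEntropy μ (fun ω => (f ω, g ω, ())) :=
    rvEntropy_le_of_kernel hμ.1 _ _ (by simp)
  have h3 : rvEntropy μ (fun ω => (f ω, ())) ≤ rvEntropy μ f :=
    rvEntropy_le_of_kernel hμ.1 _ _ (by simp)
  have h4 : rvEntropy μ (fun ω => (g ω, ())) ≤ rvEntropy μ g :=
    rvEntropy_le_of_kernel hμ.1 _ _ (by simp)
  have h5 := rvEntropy_unit hμ
  linarith

/-- Independence bound with a common reference law `q` for the coordinates. -/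
lemma rvEntropy_pi_le {ι : Type*} [Fintype ι] [DecidableEq ι] [Fintype A] {μ : Ω → ℝ}
    (hμ : μ ∈ stdSimplex ℝ Ω) (f : Ω → ι → A) (q : ι → A → ℝ)
    (hq : ∀ j, q j ∈ stdSimplex ℝ A) (hpos : ∀ ω j, 0 < μ ω → 0 < q j (f ω j)) :
    rvEntropy μ f ≤ -∑ j, ∑ ω, μ ω * Real.logb 2 (q j (f ω j)) := by
  refine (rvEntropy_le_of_subprob hμ f (fun a => ∏ j, q j (a j))
    (fun a => Finset.prod_nonneg fun j _ => (hq j).1 _) ?_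
    (fun ω h => Finset.prod_pos fun j _ => hpos ω j h)).trans_eq ?_
  · rw [← Fintype.piFinset_univ, ← Finset.prod_univ_sum]
    simp [(hq _).2]
  · rw [Finset.sum_comm]
    congr 1
    refine Finset.sum_congr rfl fun ω _ => ?_
    rcases (hμ.1 ω).eq_or_lt with h0 | h0
    · simp [← h0]
    · rw [Real.logb_prod _ _ fun j _ => (hpos ω j h0).ne', Finset.mul_sum]

lemma entropy_le_log_card [Fintype A] {p : A → ℝ} (hp : p ∈ stdSimplex ℝ A) :
    entropy p ≤ Real.logb 2 (Fintype.card A) := by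
  have h : mass p id = p := by
    classical
    ext a
    simp [mass, Finset.sum_filter]
  rw [← h, entropy_mass]
  exact rvEntropy_le_log_card hp id

lemma entropy_nonneg [Fintype A] {p : A → ℝ} (hp : p ∈ stdSimplex ℝ A) : 0 ≤ entropy p := by
  rw [entropy, ← Finset.sum_neg_distrib]
  refine Finset.sum_nonneg fun a _ => ?_
  have h1 : p a ≤ 1 := hp.2 ▸ Finset.single_le_sum (fun a _ => hp.1 a) (Finset.mem_univ a)
  have := Real.logb_nonpos (b := 2) (by norm_num) (hp.1 a) h1
  nlinarith [hp.1 a]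

end RandomVariables

/-! ### Marginals of product laws -/

section ProductLaw

variable {ι κ Y : Type*} [Fintype ι] [DecidableEq ι] [Fintype κ] [Fintype Y]

lemma sum_prod_eq_one {p : ι → Y → ℝ} (hp : ∀ t, p t ∈ stdSimplex ℝ Y) :
    ∑ y : ι → Y, ∏ t, p t (y t) = 1 := by
  rw [← Fintype.piFinset_univ, ← Finset.prod_univ_sum]
  simp [(hp _).2]

lemma sum_prod_mul_coord {p : ι → Y → ℝ} (hp : ∀ t, p t ∈ stdSimplex ℝ Y) (t₀ : ι) (F : Y → ℝ) :
    ∑ y : ι → Y, (∏ t, p t (y t)) * F (y t₀) = ∑ b, p t₀ b * F b := by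
  have h := Finset.prod_univ_sum (fun _ : ι => (Finset.univ : Finset Y))
    -- `F` is absorbed into the factor at `t₀`, so that the sum over `y` factorizes.
    (fun t b => p t b * if t = t₀ then F b else 1)
  rw [Fintype.piFinset_univ] at h
  simp only [Finset.prod_mul_distrib, Finset.prod_ite_eq', Finset.mem_univ, if_true] at h
  rw [← h, ← Finset.mul_prod_erase _ _ (Finset.mem_univ t₀), Finset.prod_eq_one]
  · simp
  · intro t ht
    simp [Finset.ne_of_mem_erase ht, (hp t).2]

open scoped Classical in
lemma sum_prod_agree {p : ι → Y → ℝ} (hp : ∀ t, p t ∈ stdSimplex ℝ Y) (e : κ ↪ ι) (b : κ → Y) :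
    ∑ y : ι → Y with (fun j => y (e j)) = b, ∏ t, p t (y t) = ∏ j, p (e j) (b j) := by
  have h := Finset.prod_univ_sum (fun _ : ι => (Finset.univ : Finset Y))
    (fun t c => p t c * if ∀ j, e j = t → c = b j then 1 else 0)
  rw [Fintype.piFinset_univ] at h
  simp only [Finset.prod_mul_distrib] at h
  have hl : ∀ y : ι → Y, (∏ t, p t (y t)) * ∏ t, (if ∀ j, e j = t → y t = b j then (1 : ℝ) else 0)
      = if (fun j => y (e j)) = b then ∏ t, p t (y t) else 0 := by
    intro y
    rw [Finset.prod_ite_zero]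
    have : (∀ t ∈ Finset.univ, ∀ j, e j = t → y t = b j) ↔ (fun j => y (e j)) = b := by
      constructor
      · intro h
        exact funext fun j => h _ (Finset.mem_univ _) j rfl
      · rintro rfl t _ j rfl
        rfl
    simp only [this]
    split_ifs <;> simp
  rw [Finset.sum_filter, ← Finset.sum_congr rfl fun y _ => hl y, ← h,
    ← Finset.prod_subset (Finset.subset_univ (Finset.univ.map e)), Finset.prod_map]
  · refine Finset.prod_congr rfl fun j _ => ?_
    have : ∀ c, (∀ j', e j' = e j → c = b j') ↔ c = b j := fun c =>
      ⟨fun h => h j rfl, fun h j' hj' => by rw [e.injective hj', h]⟩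
    simp only [this]
    simp
  · intro t _ ht
    have : ∀ c, ∀ j, e j = t → c = b j := by
      rintro c j rfl
      simp at ht
    refine (Finset.sum_congr rfl fun c _ => ?_).trans (hp t).2
    rw [if_pos (this c), mul_one]

end ProductLaw

/-! ### The random block -/

section Blocks

variable {k ℓ : ℕ} {A : Type*}

/-- The `i`-th block of length `ℓ`. -/
def block (w : Fin (k * ℓ) → A) (i : Fin k) : Fin ℓ → A :=
  fun j => w (finProdFinEquiv (i, j))

/-- The positions of the `i`-th block of length `ℓ`. -/
def blockEmb (i : Fin k) : Fin ℓ ↪ Fin (k * ℓ) :=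
  ⟨fun j => finProdFinEquiv (i, j), fun _ _ h =>
    (Prod.ext_iff.1 (finProdFinEquiv.injective h)).2⟩

/-- Uniform choice of a block, together with independent output letters. -/
noncomputable def blockLaw (k ℓ : ℕ) {Y : Type*} (p : Fin (k * ℓ) → Y → ℝ)
    (ω : Fin k × (Fin (k * ℓ) → Y)) : ℝ :=
  (k : ℝ)⁻¹ * ∏ t, p t (ω.2 t)

lemma sum_positions (F : Fin (k * ℓ) → ℝ) :
    ∑ t, F t = ∑ j : Fin ℓ, ∑ i : Fin k, F (finProdFinEquiv (i, j)) := by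
  rw [← finProdFinEquiv.sum_comp, Fintype.sum_prod_type, Finset.sum_comm]

variable {Y : Type*} [Fintype Y] {p : Fin (k * ℓ) → Y → ℝ}

lemma blockLaw_mem_stdSimplex (hk : 0 < k) (hp : ∀ t, p t ∈ stdSimplex ℝ Y) :
    blockLaw k ℓ p ∈ stdSimplex ℝ (Fin k × (Fin (k * ℓ) → Y)) := by
  refine ⟨fun ω => mul_nonneg (by positivity) (Finset.prod_nonneg fun t _ => (hp t).1 _), ?_⟩
  rw [Fintype.sum_prod_type]
  simp only [blockLaw, ← Finset.mul_sum, sum_prod_eq_one hp]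
  simp [hk.ne']

lemma sum_blockLaw_mul (G : Fin k → (Fin (k * ℓ) → Y) → ℝ) :
    ∑ ω, blockLaw k ℓ p ω * G ω.1 ω.2
      = (k : ℝ)⁻¹ * ∑ i, ∑ y, (∏ t, p t (y t)) * G i y := by
  rw [Fintype.sum_prod_type, Finset.mul_sum]
  refine Finset.sum_congr rfl fun i _ => ?_
  rw [Finset.mul_sum]
  exact Finset.sum_congr rfl fun y _ => mul_assoc _ _ _

lemma sum_blockLaw_coord (hp : ∀ t, p t ∈ stdSimplex ℝ Y) (j : Fin ℓ) (F : Fin k → Y → ℝ) :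
    ∑ ω, blockLaw k ℓ p ω * F ω.1 (block ω.2 ω.1 j)
      = (k : ℝ)⁻¹ * ∑ i, ∑ b, p (finProdFinEquiv (i, j)) b * F i b := by
  rw [sum_blockLaw_mul (fun i y => F i (block y i j))]
  congr 1
  exact Finset.sum_congr rfl fun i _ => sum_prod_mul_coord hp (finProdFinEquiv (i, j)) (F i)

lemma mass_index (hp : ∀ t, p t ∈ stdSimplex ℝ Y) (i : Fin k) :
    mass (blockLaw k ℓ p) Prod.fst i = (k : ℝ)⁻¹ := by
  classical
  rw [mass, Finset.sum_filter, Fintype.sum_prod_type, Finset.sum_eq_single i]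
  · simp only [if_true, blockLaw, ← Finset.mul_sum, sum_prod_eq_one hp, mul_one]
  · intro i' _ h
    simp [h]
  · simp

lemma mass_block_index (hp : ∀ t, p t ∈ stdSimplex ℝ Y) (b : Fin ℓ → Y) (i : Fin k) :
    mass (blockLaw k ℓ p) (fun ω => (block ω.2 ω.1, ω.1)) (b, i)
      = (k : ℝ)⁻¹ * ∏ j, p (finProdFinEquiv (i, j)) (b j) := by
  classical
  rw [mass, Finset.sum_filter, Fintype.sum_prod_type, Finset.sum_eq_single i]
  · have := sum_prod_agree hp (blockEmb i) b
    rw [Finset.sum_filter] at this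
    change _ = (k : ℝ)⁻¹ * ∏ j, p (blockEmb i j) (b j)
    rw [← this, Finset.mul_sum]
    refine Finset.sum_congr rfl fun y _ => ?_
    simp only [Prod.mk.injEq, and_true, blockLaw, mul_ite, mul_zero]
    rfl
  · intro i' _ h
    simp [h]
  · simp

/-- The conditional entropy of the output block given the index of the block. -/
lemma rvEntropy_block_index (hk : 0 < k) (hp : ∀ t, p t ∈ stdSimplex ℝ Y) :
    rvEntropy (blockLaw k ℓ p) (fun ω => (block ω.2 ω.1, ω.1))
      = rvEntropy (blockLaw k ℓ p) Prod.fst + (k : ℝ)⁻¹ * ∑ t, entropy (p t) := by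
  have hμ := blockLaw_mem_stdSimplex (ℓ := ℓ) hk hp
  have hk' : (k : ℝ)⁻¹ ≠ 0 := by positivity
  have hterm : ∀ ω, blockLaw k ℓ p ω * Real.logb 2 (mass (blockLaw k ℓ p)
        (fun ω => (block ω.2 ω.1, ω.1)) (block ω.2 ω.1, ω.1))
      = blockLaw k ℓ p ω * Real.logb 2 (mass (blockLaw k ℓ p) Prod.fst ω.1)
        + ∑ j, blockLaw k ℓ p ω
          * Real.logb 2 (p (finProdFinEquiv (ω.1, j)) (block ω.2 ω.1 j)) := by
    intro ω
    rcases (hμ.1 ω).eq_or_lt with h0 | h0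
    · simp [← h0]
    · have hne : ∀ t, p t (ω.2 t) ≠ 0 := by
        have : ∏ t, p t (ω.2 t) ≠ 0 := right_ne_zero_of_mul h0.ne'
        exact fun t => Finset.prod_ne_zero_iff.1 this t (Finset.mem_univ t)
      have hne' : ∀ j ∈ Finset.univ, p (finProdFinEquiv (ω.1, j)) (block ω.2 ω.1 j) ≠ 0 :=
        fun j _ => hne _
      rw [mass_block_index hp, mass_index hp,
        Real.logb_mul hk' (Finset.prod_ne_zero_iff.2 hne'), Real.logb_prod _ _ hne', mul_add,
        Finset.mul_sum]
  have hcoord : ∑ ω, ∑ j, blockLaw k ℓ p ω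
        * Real.logb 2 (p (finProdFinEquiv (ω.1, j)) (block ω.2 ω.1 j))
      = -((k : ℝ)⁻¹ * ∑ t, entropy (p t)) := by
    rw [Finset.sum_comm, sum_positions, Finset.mul_sum, ← Finset.sum_neg_distrib]
    refine Finset.sum_congr rfl fun j _ => ?_
    rw [sum_blockLaw_coord hp j (fun i b => Real.logb 2 (p (finProdFinEquiv (i, j)) b)),
      ← mul_neg, ← Finset.sum_neg_distrib]
    simp only [entropy, neg_neg]
  rw [rvEntropy, rvEntropy, Finset.sum_congr rfl fun ω _ => hterm ω, Finset.sum_add_distrib,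
    hcoord]
  ring

end Blocks

/-! ### Capacity bounds for the output block -/

section Capacity

variable {X Y : Type*} [Fintype X] [Fintype Y] {P : X → Y → ℝ}

lemma output_mem_stdSimplex (hP : IsChannel P) {p : X → ℝ} (hp : p ∈ stdSimplex ℝ X) :
    (fun y => ∑ x, p x * P x y) ∈ stdSimplex ℝ Y := by
  refine ⟨fun y => Finset.sum_nonneg fun x _ => mul_nonneg (hp.1 x) ((hP x).1 y), ?_⟩
  rw [Finset.sum_comm]
  simp [← Finset.mul_sum, (hP _).2, hp.2]

lemma mutualInfo_le_capacity (hP : IsChannel P) {p : X → ℝ} (hp : p ∈ stdSimplex ℝ X) :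
    mutualInfo p P ≤ capacity P := by
  refine le_csSup ⟨Real.logb 2 (Fintype.card Y), ?_⟩ ⟨p, hp, rfl⟩
  rintro _ ⟨q, hq, rfl⟩
  have h1 := entropy_le_log_card (output_mem_stdSimplex hP hq)
  have h2 : 0 ≤ ∑ x, q x * entropy (P x) :=
    Finset.sum_nonneg fun x _ => mul_nonneg (hq.1 x) (entropy_nonneg (hP x))
  change entropy _ - _ ≤ _
  linarith

lemma capacity_nonneg [Nonempty X] (hP : IsChannel P) : 0 ≤ capacity P := by
  classical
  obtain ⟨x⟩ := ‹Nonempty X›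
  refine le_trans (le_of_eq ?_) (mutualInfo_le_capacity hP (single_mem_stdSimplex ℝ x))
  simp [mutualInfo, Pi.single_apply]

/-- The output block carries at most `ℓ` times the capacity about the index of the block. -/
lemma rvEntropy_output_block_le {k ℓ : ℕ} (hk : 0 < k) (hP : IsChannel P) (x : Fin (k * ℓ) → X) :
    rvEntropy (blockLaw k ℓ fun t => P (x t)) (fun ω => block ω.2 ω.1)
      ≤ ℓ * capacity P + (k : ℝ)⁻¹ * ∑ t, entropy (P (x t)) := by
  classical
  have hp : ∀ t, P (x t) ∈ stdSimplex ℝ Y := fun t => hP _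
  have hμ := blockLaw_mem_stdSimplex (ℓ := ℓ) hk hp
  have h1 := rvEntropy_pi_le hμ (fun ω => block ω.2 ω.1)
    (fun j => mass (blockLaw k ℓ fun t => P (x t)) (fun ω => block ω.2 ω.1 j))
    (fun j => mass_mem_stdSimplex hμ _)
    (fun ω j h => h.trans_le (le_mass hμ.1 (fun ω => block ω.2 ω.1 j) ω))
  refine h1.trans ?_
  -- The `j`-th output letter of the random block is the channel output for the empirical law of the
  -- inputs at offset `j`, so its mutual information with that input is at most the capacity.
  have hcap : ∀ j : Fin ℓ, entropy (mass (blockLaw k ℓ fun t => P (x t))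
        (fun ω => block ω.2 ω.1 j))
      ≤ capacity P + (k : ℝ)⁻¹ * ∑ i, entropy (P (x (finProdFinEquiv (i, j)))) := by
    intro j
    have hν : (fun _ : Fin k => (k : ℝ)⁻¹) ∈ stdSimplex ℝ (Fin k) :=
      ⟨fun _ => by positivity, by simp [hk.ne']⟩
    have hC := mutualInfo_le_capacity hP
      (mass_mem_stdSimplex hν fun i : Fin k => x (finProdFinEquiv (i, j)))
    have hout : (fun y => ∑ a, mass (fun _ : Fin k => (k : ℝ)⁻¹)
          (fun i => x (finProdFinEquiv (i, j))) a * P a y)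
        = mass (blockLaw k ℓ fun t => P (x t)) (fun ω => block ω.2 ω.1 j) := by
      ext y
      rw [sum_mass_mul _ _ (fun a => P a y)]
      have h := sum_blockLaw_coord hp j (fun _ b => if b = y then 1 else 0)
      simp only [mul_ite, mul_one, mul_zero, Finset.sum_ite_eq', Finset.mem_univ, if_true] at h
      rw [mass, Finset.sum_filter, h, Finset.mul_sum]
    rw [mutualInfo, hout, sum_mass_mul _ _ (fun a => entropy (P a)), ← Finset.mul_sum] at hC
    linarith
  rw [sum_positions, Finset.mul_sum]
  calc _ = ∑ j : Fin ℓ, entropy (mass (blockLaw k ℓ fun t => P (x t))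
        (fun ω => block ω.2 ω.1 j)) := by
        rw [← Finset.sum_neg_distrib]
        exact Finset.sum_congr rfl fun j _ => (entropy_mass _ _).symm
    _ ≤ ∑ j : Fin ℓ, (capacity P
          + (k : ℝ)⁻¹ * ∑ i, entropy (P (x (finProdFinEquiv (i, j))))) :=
        Finset.sum_le_sum fun j _ => hcap j
    _ = _ := by
        rw [Finset.sum_add_distrib]
        simp

end Capacity

/-! ### The decoder within one block -/

section DecoderBlocks

variable {k ℓ : ℕ} {Z Y V : Type*}

lemma index_lt (i : Fin k) {m : ℕ} (hm : m < ℓ) : ℓ * i + m < k * ℓ := by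
  have : ((finProdFinEquiv (i, (⟨m, hm⟩ : Fin ℓ)) : Fin (k * ℓ)) : ℕ) < k * ℓ := Fin.isLt _
  simp only [finProdFinEquiv_apply_val] at this
  omega

lemma block_mk (w : Fin (k * ℓ) → V) (i : Fin k) {m : ℕ} (hm : m < ℓ) :
    block w i ⟨m, hm⟩ = w ⟨ℓ * i + m, index_lt i hm⟩ := by
  unfold block
  congr 1
  apply Fin.ext
  simp only [finProdFinEquiv_apply_val]
  omega

/-- Within a block, the state is determined by the state at the start of the block and the
outputs of the channel in the block. -/
lemma Decoder.state_eq_of_block_eq (D : Decoder Z Y V) {y y' : Fin (k * ℓ) → Y} {i i' : Fin k}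
    (hz : D.state ℓ y (ℓ * i) = D.state ℓ y' (ℓ * i')) (hb : block y i = block y' i') :
    ∀ m ≤ ℓ, D.state ℓ y (ℓ * i + m) = D.state ℓ y' (ℓ * i' + m) := by
  intro m
  induction m with
  | zero => exact fun _ => hz
  | succ m ih =>
    intro hm
    have hm' : m < ℓ := hm
    have hy := congrFun hb ⟨m, hm'⟩
    rw [block_mk, block_mk] at hy
    -- Blocks start at multiples of `ℓ`, so the counter shows the same value at the same offset of
    -- every block.
    have e : ∀ a : ℕ, (ℓ * a + m + 1) % ℓ = (m + 1) % ℓ := fun a => by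
      rw [add_assoc, Nat.mul_add_mod]
    rw [← Nat.add_assoc, ← Nat.add_assoc, Decoder.state, Decoder.state, dif_pos (index_lt i hm'),
      dif_pos (index_lt i' hm'), e, e, ih hm'.le, hy]

/-- With delay `d`, all but the last `d` reconstructed symbols of a block are determined by the
state at the start of the block and the outputs of the channel in the block. -/
lemma Decoder.recon_eq_of_block_eq (D : Decoder Z Y V) {d : ℕ}
    (tail : (Fin (k * ℓ) → Y) → Fin (k * ℓ) → V) {y y' : Fin (k * ℓ) → Y} {i i' : Fin k}
    (hz : D.state ℓ y (ℓ * i) = D.state ℓ y' (ℓ * i')) (hb : block y i = block y' i')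
    (j : Fin ℓ) (hj : j + d < ℓ) :
    block (D.recon ℓ d tail y) i j = block (D.recon ℓ d tail y') i' j := by
  have hs := D.state_eq_of_block_eq hz hb (j + d) hj.le
  have hy := congrFun hb ⟨j + d, hj⟩
  rw [block_mk, block_mk] at hy
  have e : ∀ a : ℕ, (ℓ * a + (j + d) + 1) % ℓ = (j + d + 1) % ℓ := fun a => by
    rw [add_assoc, Nat.mul_add_mod]
  change block _ i ⟨j, j.2⟩ = block _ i' ⟨j, j.2⟩
  rw [block_mk, block_mk]
  simp only [Decoder.recon, Nat.add_assoc (ℓ * _) (j : ℕ) d, dif_pos (index_lt i hj),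
    dif_pos (index_lt i' hj), e, hs, hy]

end DecoderBlocks

/-! ### Upper bound for the entropy of a source block -/

section Converse

variable {k ℓ : ℕ} {U X Y Z : Type*} [AddGroup U] [Fintype U] [Fintype X] [Fintype Y] [Fintype Z]
  {P : X → Y → ℝ}

/-- The symbols whose decoding falls beyond the end of the block: `j ↦ j + d - ℓ` injects their
positions into `Fin d`, also when `ℓ ≤ d`. -/
lemma log_card_undecoded_le (d : ℕ) :
    Real.logb 2 (Fintype.card ({j : Fin ℓ // ℓ ≤ j + d} → U))
      ≤ d * Real.logb 2 (Fintype.card U) := by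
  have hU : 1 ≤ (Fintype.card U : ℝ) := by exact_mod_cast Fintype.card_pos
  have hd : Fintype.card {j : Fin ℓ // ℓ ≤ j + d} ≤ d := by
    have h := Fintype.card_le_of_injective
      (fun j : {j : Fin ℓ // ℓ ≤ j + d} => (⟨j.1 + d - ℓ, by omega⟩ : Fin d))
      (fun a b h => by
        have := Fin.mk.inj_iff.1 h
        apply Subtype.ext
        apply Fin.ext
        omega)
    simpa using h
  rw [Fintype.card_fun, Nat.cast_pow, Real.logb_pow]
  exact mul_le_mul_of_nonneg_right (by exact_mod_cast hd) (Real.logb_nonneg (by norm_num) hU)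

/-- The entropy of a source block, bounded in terms of the entropy of an error block. -/
lemma rvEntropy_source_block_le (hk : 0 < k) (hP : IsChannel P) (u : Fin (k * ℓ) → U)
    (x : Fin (k * ℓ) → X) (d : ℕ) (D : Decoder Z Y U)
    (tail : (Fin (k * ℓ) → Y) → Fin (k * ℓ) → U) :
    rvEntropy (blockLaw k ℓ fun t => P (x t)) (fun ω => block u ω.1)
      ≤ rvEntropy (blockLaw k ℓ fun t => P (x t))
          (fun ω => block (fun t => D.recon ℓ d tail ω.2 t - u t) ω.1)
        + ℓ * capacity P + Real.logb 2 (Fintype.card Z) + d * Real.logb 2 (Fintype.card U) := by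
  classical
  have hp : ∀ t, P (x t) ∈ stdSimplex ℝ Y := fun t => hP _
  have hμ := blockLaw_mem_stdSimplex (ℓ := ℓ) hk hp
  set μ := blockLaw k ℓ fun t => P (x t) with hμdef
  let fU := fun ω : Fin k × (Fin (k * ℓ) → Y) => block u ω.1
  let fY := fun ω : Fin k × (Fin (k * ℓ) → Y) => block ω.2 ω.1
  let fV := fun ω : Fin k × (Fin (k * ℓ) → Y) => block (D.recon ℓ d tail ω.2) ω.1
  let fW := fun ω : Fin k × (Fin (k * ℓ) → Y) =>
    block (fun t => D.recon ℓ d tail ω.2 t - u t) ω.1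
  let fZ := fun ω : Fin k × (Fin (k * ℓ) → Y) => D.state ℓ ω.2 (ℓ * ω.1)
  let fT := fun (ω : Fin k × (Fin (k * ℓ) → Y)) (j : {j : Fin ℓ // ℓ ≤ j + d}) => fV ω j
  let fQ := fun ω => (fZ ω, fY ω, fT ω)
  have hVQ : ∀ ω ω', fQ ω = fQ ω' → fV ω = fV ω' := by
    intro ω ω' h
    simp only [fQ, Prod.mk.injEq] at h
    ext j
    by_cases hj : (j : ℕ) + d < ℓ
    · exact D.recon_eq_of_block_eq tail h.1 h.2.1 j hj
    · exact congrFun h.2.2 ⟨j, not_lt.1 hj⟩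
  have h1 : rvEntropy μ (fun ω => (fU ω, fV ω)) ≤ rvEntropy μ (fun ω => (fW ω, fV ω)) := by
    refine rvEntropy_le_of_kernel hμ.1 _ _ fun ω ω' h => ?_
    simp only [Prod.mk.injEq] at h ⊢
    refine ⟨funext fun j => ?_, h.2⟩
    have hW : fV ω j - fU ω j = fV ω' j - fU ω' j := congrFun h.1 j
    rw [h.2] at hW
    exact sub_right_inj.1 hW
  have h2 := rvEntropy_pair_le hμ fW fV
  -- With `h1`, `h2` and `h4` the entropy of `fV` cancels, leaving H(Y,U) ≤ H(W) + H(Q).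
  have h3 := rvEntropy_submodular hμ fU fQ fV
  have h4 : rvEntropy μ (fun ω => (fQ ω, fV ω)) ≤ rvEntropy μ fQ :=
    rvEntropy_le_of_kernel hμ.1 _ _ fun ω ω' h => Prod.ext h (hVQ ω ω' h)
  have h5 : rvEntropy μ (fun ω => (fY ω, fU ω)) ≤ rvEntropy μ (fun ω => (fU ω, fQ ω, fV ω)) :=
    rvEntropy_le_of_kernel hμ.1 _ _ fun ω ω' h => by
      simp only [Prod.mk.injEq, fQ] at h ⊢
      exact ⟨h.2.1.2.1, h.1⟩
  have h6 : rvEntropy μ fQ ≤ rvEntropy μ fZ + (rvEntropy μ fY + rvEntropy μ fT) :=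
    (rvEntropy_pair_le hμ fZ fun ω => (fY ω, fT ω)).trans
      (add_le_add_right (rvEntropy_pair_le hμ fY fT) _)
  -- Data processing: with `h8`–`h10` this gives H(U) + H(Y|I) ≤ H(Y,U), where H(Y|I) is the average
  -- output noise that `h11` removes from H(Y).
  have h7 := rvEntropy_submodular hμ fY Prod.fst fU
  have h8 : rvEntropy μ (fun ω => (ω.1, fU ω)) ≤ rvEntropy μ Prod.fst :=
    rvEntropy_le_of_kernel hμ.1 _ _ fun ω ω' h => by simp only [fU, h]
  have h9 : rvEntropy μ (fun ω => (fY ω, ω.1)) ≤ rvEntropy μ (fun ω => (fY ω, ω.1, fU ω)) :=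
    rvEntropy_le_of_kernel hμ.1 _ _ fun ω ω' h => by
      simp only [Prod.mk.injEq] at h ⊢
      exact ⟨h.1, h.2.1⟩
  have h10 : rvEntropy μ (fun ω => (fY ω, ω.1)) = _ := rvEntropy_block_index hk hp
  have h11 : rvEntropy μ fY ≤ _ := rvEntropy_output_block_le hk hP x
  have h12 := rvEntropy_le_log_card hμ fZ
  have h13 := (rvEntropy_le_log_card hμ fT).trans (log_card_undecoded_le d)
  change rvEntropy μ fU ≤ rvEntropy μ fW + _ + _ + _
  linarith

/-- A single-letter error law with the average distortion of the scheme, whose entropy bounds the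
entropy of a source block. -/
lemma exists_error_law (hk : 0 < k) (hℓ : 0 < ℓ) (hP : IsChannel P) (u : Fin (k * ℓ) → U)
    (x : Fin (k * ℓ) → X) (d : ℕ) (D : Decoder Z Y U)
    (tail : (Fin (k * ℓ) → Y) → Fin (k * ℓ) → U) (ϱ : U → ℝ) :
    ∃ q ∈ stdSimplex ℝ U,
      ∑ w, q w * ϱ w = (1 / ((k * ℓ : ℕ) : ℝ)) * ∑ t, expect P x
        (fun y => ϱ (D.recon ℓ d tail y t - u t)) ∧
      rvEntropy (blockLaw k ℓ fun t => P (x t)) (fun ω => block u ω.1)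
        ≤ ℓ * entropy q + ℓ * capacity P + Real.logb 2 (Fintype.card Z)
          + d * Real.logb 2 (Fintype.card U) := by
  classical
  have hp : ∀ t, P (x t) ∈ stdSimplex ℝ Y := fun t => hP _
  have hμ := blockLaw_mem_stdSimplex (ℓ := ℓ) hk hp
  have hmain := rvEntropy_source_block_le hk hP u x d D tail
  set μ := blockLaw k ℓ fun t => P (x t) with hμdef
  let W := fun (j : Fin ℓ) (ω : Fin k × (Fin (k * ℓ) → Y)) =>
    block (fun t => D.recon ℓ d tail ω.2 t - u t) ω.1 j
  have hℓ' : 0 < (ℓ : ℝ) := by exact_mod_cast hℓ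
  let q : U → ℝ := fun w => (ℓ : ℝ)⁻¹ * ∑ j, mass μ (W j) w
  have hqsum : ∀ F : U → ℝ, ∑ w, q w * F w = (ℓ : ℝ)⁻¹ * ∑ j, ∑ ω, μ ω * F (W j ω) := by
    intro F
    simp only [q, mul_assoc, Finset.sum_mul, ← Finset.mul_sum]
    rw [Finset.sum_comm]
    simp only [sum_mass_mul]
  have hq : q ∈ stdSimplex ℝ U := by
    refine ⟨fun w => mul_nonneg (by positivity)
      (Finset.sum_nonneg fun j _ => mass_nonneg hμ.1 _ _), ?_⟩
    have := hqsum fun _ => 1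
    simpa [hμ.2, hℓ.ne'] using this
  refine ⟨q, hq, ?_, hmain.trans ?_⟩
  · rw [hqsum, sum_positions, Nat.cast_mul, one_div, mul_inv, mul_comm (k : ℝ)⁻¹, mul_assoc,
      Finset.mul_sum (a := (k : ℝ)⁻¹)]
    congr 1
    refine Finset.sum_congr rfl fun j _ => ?_
    exact sum_blockLaw_mul fun i y => ϱ (block (fun t => D.recon ℓ d tail y t - u t) i j)
  -- Using the averaged law `q` as reference at every position gives `ℓ * entropy q` at once,
  -- replacing subadditivity followed by concavity of entropy.
  · have h := rvEntropy_pi_le hμ (fun ω j => W j ω) (fun _ => q) (fun _ => hq) ?_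
    · have h2 : -∑ j, ∑ ω, μ ω * Real.logb 2 (q (W j ω)) = ℓ * entropy q := by
        rw [entropy, hqsum fun w => Real.logb 2 (q w)]
        field_simp
      rw [h2] at h
      have h' : rvEntropy μ (fun ω => block (fun t => D.recon ℓ d tail ω.2 t - u t) ω.1)
        ≤ ℓ * entropy q := h
      linarith
    · intro ω j h0
      refine mul_pos (by positivity) ((h0.trans_le (le_mass hμ.1 (W j) ω)).trans_le ?_)
      exact Finset.single_le_sum (f := fun j' => mass μ (W j') (W j ω))
        (fun j' _ => mass_nonneg hμ.1 _ _) (Finset.mem_univ j)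

end Converse

/-! ### Counting phrases by length -/

section Phrases

variable {A : Type*}

lemma length_le_length_flatten {L : List (List A)} (h : ∀ p ∈ L, p ≠ []) :
    L.length ≤ L.flatten.length := by
  induction L with
  | nil => simp
  | cons p L ih =>
    have h1 := List.length_pos_iff.2 (h p (by simp))
    have h2 := ih fun q hq => h q (by simp [hq])
    simp only [List.length_cons, List.flatten_cons, List.length_append]
    omega

lemma mul_countP_le_length_flatten (L : List (List A)) (m : ℕ) :
    m * L.countP (fun p => m < p.length) ≤ L.flatten.length := by
  induction L with
  | nil => simp
  | cons p L ih =>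
    rw [List.countP_cons, List.flatten_cons, List.length_append]
    split_ifs with h
    · have : m < p.length := by simpa using h
      rw [mul_add]
      omega
    · rw [add_zero]
      omega

end Phrases

/-! ### Incremental parsing and the number of phrases -/

section Parsing

variable {A : Type*} [DecidableEq A]

/-- Every completed phrase is new when it is appended; only the final incomplete phrase, isolated in
`last`, may repeat an earlier one. -/
lemma lzParseAux_spec (rest : List A) : ∀ (pre : List (List A)) (cur : List A), pre.Nodup →
    ∃ new last, lzParseAux pre cur rest = pre ++ new ++ last ∧ (pre ++ new).Nodup ∧
      last.length ≤ 1 ∧ (new ++ last).flatten = cur ++ rest ∧ ∀ p ∈ new ++ last, p ≠ [] := by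
  induction rest with
  | nil =>
    intro pre cur h
    by_cases hc : cur = []
    · exact ⟨[], [], by simp [lzParseAux, hc, h]⟩
    · exact ⟨[], [cur], by simp [lzParseAux, hc, h]⟩
  | cons a rest ih =>
    intro pre cur h
    by_cases hm : cur ++ [a] ∈ pre
    · obtain ⟨new, last, h1, h2, h3, h4, h5⟩ := ih pre (cur ++ [a]) h
      exact ⟨new, last, by rw [lzParseAux, if_pos hm, h1], h2, h3, by rw [h4]; simp, h5⟩
    · have hn : (pre ++ [cur ++ [a]]).Nodup := by
        rw [List.nodup_append_comm]
        simp [hm, h]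
      obtain ⟨new, last, h1, h2, h3, h4, h5⟩ := ih (pre ++ [cur ++ [a]]) [] hn
      refine ⟨(cur ++ [a]) :: new, last, ?_, ?_, h3, ?_, ?_⟩
      · rw [lzParseAux, if_neg hm, h1]
        simp
      · simpa using h2
      · rw [List.cons_append, List.flatten_cons, h4]
        simp
      · rw [List.cons_append]
        intro p hp
        rcases List.mem_cons.1 hp with rfl | hp
        · simp
        · exact h5 p hp

lemma lzParse_spec (w : List A) : ∃ new last, lzParse w = new ++ last ∧ new.Nodup ∧
    last.length ≤ 1 ∧ (new ++ last).flatten = w ∧ ∀ p ∈ new ++ last, p ≠ [] := by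
  simpa [lzParse] using lzParseAux_spec w [] [] List.nodup_nil

lemma lzCount_le {n : ℕ} (u : Fin n → A) : lzCount u ≤ n := by
  obtain ⟨new, last, h1, -, -, h4, h5⟩ := lzParse_spec (List.ofFn u)
  have := length_le_length_flatten h5
  rw [h4, List.length_ofFn] at this
  rwa [lzCount, h1]

lemma lzCount_pos {n : ℕ} (hn : 0 < n) (u : Fin n → A) : 0 < lzCount u := by
  obtain ⟨new, last, h1, -, -, h4, -⟩ := lzParse_spec (List.ofFn u)
  rw [lzCount, h1, List.length_pos_iff]
  intro h
  rw [h] at h4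
  have := congrArg List.length h4
  simp at this
  omega

variable (A) [Fintype A]

/-- The words of length at most `m`. -/
def words : ℕ → Finset (List A)
  | 0 => {[]}
  | m + 1 => insert [] ((Finset.univ ×ˢ words m).image fun p => p.1 :: p.2)

variable {A}

lemma mem_words {m : ℕ} {w : List A} : w.length ≤ m → w ∈ words A m := by
  induction m generalizing w with
  | zero => simp [words]
  | succ m ih =>
    cases w with
    | nil => simp [words]
    | cons a w =>
      intro h
      simp only [words, Finset.mem_insert, Finset.mem_image, Finset.mem_product, Finset.mem_univ,
        true_and, Prod.exists]
      exact Or.inr ⟨a, w, ih (by simpa using h), rfl⟩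

lemma card_words_le (m : ℕ) : (words A m).card ≤ (Fintype.card A + 1) ^ m := by
  induction m with
  | zero => simp [words]
  | succ m ih =>
    have h1 : (words A (m + 1)).card ≤ Fintype.card A * (words A m).card + 1 := by
      refine (Finset.card_insert_le _ _).trans (Nat.succ_le_succ ?_)
      refine Finset.card_image_le.trans_eq ?_
      rw [Finset.card_product, Finset.card_univ]
    have h2 : 1 ≤ (Fintype.card A + 1) ^ m := Nat.one_le_pow _ _ (by omega)
    calc _ ≤ Fintype.card A * (words A m).card + 1 := h1
      _ ≤ Fintype.card A * (Fintype.card A + 1) ^ m + (Fintype.card A + 1) ^ m := by gcongr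
      _ = _ := by ring

/-- The number of phrases is at most the number of short words plus the number of long phrases
plus one. -/
lemma lzCount_le_of_length {n : ℕ} (u : Fin n → A) {m : ℕ} (hm : 0 < m) :
    (lzCount u : ℝ) ≤ n / m + ((Fintype.card A : ℝ) + 1) ^ m + 1 := by
  obtain ⟨new, last, h1, h2, h3, h4, -⟩ := lzParse_spec (List.ofFn u)
  have hlong : m * new.countP (fun p => m < p.length) ≤ n := by
    refine (mul_countP_le_length_flatten new m).trans ?_
    have := congrArg List.length h4
    rw [List.flatten_append, List.length_append, List.length_ofFn] at this
    omega
  have hshort : new.countP (fun p => ¬ (decide (m < p.length) = true))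
      ≤ (Fintype.card A + 1) ^ m := by
    rw [List.countP_eq_length_filter, ← List.toFinset_card_of_nodup (h2.filter _)]
    refine (Finset.card_le_card fun w hw => ?_).trans (card_words_le m)
    apply mem_words
    simpa using (List.mem_filter.1 (List.mem_toFinset.1 hw)).2
  have hlen := List.length_eq_countP_add_countP (fun p : List A => decide (m < p.length)) (l := new)
  have hc : lzCount u = new.length + last.length := by rw [lzCount, h1, List.length_append]
  have hm' : (0 : ℝ) < m := by exact_mod_cast hm
  have e1 : (new.countP (fun p => m < p.length) : ℝ) ≤ n / m := by
    rw [le_div_iff₀ hm', mul_comm]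
    exact_mod_cast hlong
  have e2 : (new.countP (fun p => ¬ (decide (m < p.length) = true)) : ℝ)
      ≤ ((Fintype.card A : ℝ) + 1) ^ m := by exact_mod_cast hshort
  have e3 : (last.length : ℝ) ≤ 1 := by exact_mod_cast h3
  have e4 : (lzCount u : ℝ) = new.countP (fun p => m < p.length)
      + new.countP (fun p => ¬ (decide (m < p.length) = true)) + last.length := by
    rw [hc, hlen]
    push_cast
    rfl
  linarith

end Parsing

/-! ### Weighted automata and a Kraft-type bound for phrases -/

section WeightedAutomaton

variable {S A : Type*} (next : S → A → S) (g : S → A → ℝ)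

/-- The weight of a word read by a weighted automaton from the state `s`. -/
def weight : S → List A → ℝ
  | _, [] => 1
  | s, a :: w => g s a * weight (next s a) w

/-- The weights of the consecutive phrases read by a weighted automaton from the state `s`. -/
def phraseWeights : S → List (List A) → List ℝ
  | _, [] => []
  | s, p :: L => weight next g s p :: phraseWeights (p.foldl next s) L

lemma weight_append (s : S) (v w : List A) :
    weight next g s (v ++ w) = weight next g s v * weight next g (v.foldl next s) w := by
  induction v generalizing s with
  | nil => simp [weight]
  | cons a v ih => simp [weight, ih, mul_assoc]

lemma prod_phraseWeights (s : S) (L : List (List A)) :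
    (phraseWeights next g s L).prod = weight next g s L.flatten := by
  induction L generalizing s with
  | nil => simp [phraseWeights, weight]
  | cons p L ih => simp [phraseWeights, weight_append, ih]

lemma length_phraseWeights (s : S) (L : List (List A)) :
    (phraseWeights next g s L).length = L.length := by
  induction L generalizing s with
  | nil => rfl
  | cons p L ih => simp [phraseWeights, ih]

lemma phraseWeights_append (s : S) (L L' : List (List A)) :
    phraseWeights next g s (L ++ L')
      = phraseWeights next g s L ++ phraseWeights next g (L.flatten.foldl next s) L' := by
  induction L generalizing s with
  | nil => rfl
  | cons p L ih => simp [phraseWeights, ih]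

variable {next g}

lemma weight_nonneg (hg : ∀ s a, 0 ≤ g s a) (s : S) (w : List A) : 0 ≤ weight next g s w := by
  induction w generalizing s with
  | nil => exact zero_le_one
  | cons a w ih => exact mul_nonneg (hg s a) (ih _)

lemma weight_le_one (hg : ∀ s a, 0 ≤ g s a) (hg1 : ∀ s a, g s a ≤ 1) (s : S) (w : List A) :
    weight next g s w ≤ 1 := by
  induction w generalizing s with
  | nil => exact le_rfl
  | cons a w ih => exact mul_le_one₀ (hg1 s a) (weight_nonneg hg _ _) (ih _)

lemma phraseWeights_nonneg (hg : ∀ s a, 0 ≤ g s a) (s : S) (L : List (List A)) :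
    ∀ r ∈ phraseWeights next g s L, 0 ≤ r := by
  induction L generalizing s with
  | nil => simp [phraseWeights]
  | cons p L ih =>
    intro r hr
    rcases List.mem_cons.1 hr with rfl | hr
    · exact weight_nonneg hg _ _
    · exact ih _ r hr

/-- A Kraft-type inequality for all words, given a potential `B` of the states. -/
lemma sum_weight_le [Fintype A] [DecidableEq A] (hg : ∀ s a, 0 ≤ g s a) {B : S → ℝ}
    (hB1 : ∀ s, 1 ≤ B s)
    (hB : ∀ s, 1 + ∑ a, g s a * B (next s a) ≤ B s) (T : Finset (List A)) (s : S) :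
    ∑ w ∈ T, weight next g s w ≤ B s := by
  have hwords : ∀ m s, ∑ w ∈ words A m, weight next g s w ≤ B s := by
    intro m
    induction m with
    | zero => intro s; simpa [words, weight] using hB1 s
    | succ m ih =>
      intro s
      rw [words, Finset.sum_insert (by simp), Finset.sum_image (by simp +contextual [Set.InjOn])]
      refine le_trans ?_ (hB s)
      rw [Finset.sum_product]
      simp only [weight, ← Finset.mul_sum]
      gcongr with a _
      · exact hg s a
      · exact ih _
  -- A finite set of words is contained in the words of bounded length, for which the induction on
  -- first letters applies; the 1 in `hB` pays for the empty word.
  refine le_trans (Finset.sum_le_sum_of_subset_of_nonneg ?_ fun w _ _ => weight_nonneg hg s w)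
    (hwords (T.sup List.length) s)
  exact fun w hw => mem_words (Finset.le_sup (f := List.length) hw)

/-- Summing over all starting states removes the dependence on where each phrase starts, so that
distinctness of the phrases can be used one state at a time. -/
lemma sum_phraseWeights_le_sum [Fintype S] (hg : ∀ s a, 0 ≤ g s a) (s : S) (L : List (List A)) :
    (phraseWeights next g s L).sum ≤ (L.map fun p => ∑ s', weight next g s' p).sum := by
  induction L generalizing s with
  | nil => simp [phraseWeights]
  | cons p L ih =>
    simp only [phraseWeights, List.sum_cons, List.map_cons]
    exact add_le_add (Finset.single_le_sum (f := fun s' => weight next g s' p)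
      (fun s' _ => weight_nonneg hg s' p) (Finset.mem_univ s)) (ih _)

lemma sum_phraseWeights_le [Fintype S] [Fintype A] [DecidableEq A] (hg : ∀ s a, 0 ≤ g s a)
    (hg1 : ∀ s a, g s a ≤ 1) {B : S → ℝ} (hB1 : ∀ s, 1 ≤ B s)
    (hB : ∀ s, 1 + ∑ a, g s a * B (next s a) ≤ B s) {new last : List (List A)} (hnew : new.Nodup)
    (hlast : last.length ≤ 1) (s : S) :
    (phraseWeights next g s (new ++ last)).sum ≤ ∑ s', B s' + 1 := by
  rw [phraseWeights_append, List.sum_append]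
  refine add_le_add ((sum_phraseWeights_le_sum hg s new).trans ?_) ?_
  · rw [← List.sum_toFinset _ hnew, Finset.sum_comm]
    exact Finset.sum_le_sum fun s' _ => sum_weight_le hg hB1 hB _ s'
  · match last, hlast with
    | [], _ => simp [phraseWeights]
    | [p], _ => simpa [phraseWeights] using weight_le_one hg hg1 _ p

end WeightedAutomaton

/-! ### Jensen's inequality for phrase weights -/

section Jensen

/-- Sum of the tangent bounds log(αr) ≤ αr - 1. The choice α = length / S yields Jensen's
inequality. -/
lemma log_prod_le (l : List ℝ) (hl : ∀ r ∈ l, 0 < r) {α : ℝ} (hα : 0 < α) :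
    Real.log l.prod ≤ α * l.sum - l.length * (1 + Real.log α) := by
  induction l with
  | nil => simp
  | cons r l ih =>
    have hr : 0 < r := hl r (by simp)
    have hl' : ∀ r ∈ l, 0 < r := fun r h => hl r (by simp [h])
    have h1 := ih hl'
    have h2 := Real.log_le_sub_one_of_pos (mul_pos hα hr)
    rw [Real.log_mul hα.ne' hr.ne'] at h2
    rw [List.prod_cons, List.sum_cons, List.length_cons,
      Real.log_mul hr.ne' (List.prod_pos hl').ne']
    push_cast
    nlinarith

/-- Jensen's inequality for the logarithm of a product with a bounded sum of factors. -/
lemma length_mul_logb_le (l : List ℝ) (hl : ∀ r ∈ l, 0 < r) (hlen : 0 < l.length) {S : ℝ}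
    (hS : 0 < S) (hsum : l.sum ≤ S) :
    l.length * Real.logb 2 l.length ≤ -Real.logb 2 l.prod + l.length * Real.logb 2 S := by
  have hc : (0 : ℝ) < l.length := by exact_mod_cast hlen
  have h := log_prod_le l hl (div_pos hc hS)
  rw [Real.log_div hc.ne' hS.ne'] at h
  have h1 : (l.length : ℝ) / S * l.sum ≤ l.length := by
    rw [div_mul_eq_mul_div, div_le_iff₀ hS]
    exact mul_le_mul_of_nonneg_left hsum hc.le
  have h2 : 0 < Real.log 2 := Real.log_pos (by norm_num)
  have h3 : l.length * Real.log l.length ≤ -Real.log l.prod + l.length * Real.log S := by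
    nlinarith
  have h4 := div_le_div_of_nonneg_right h3 h2.le
  simp only [Real.logb]
  calc _ = _ := (mul_div_assoc _ _ _).symm
    _ ≤ _ := h4
    _ = _ := by ring

end Jensen

/-! ### The block automaton and the Lempel–Ziv lower bound -/

section BlockAutomaton

variable {ℓ : ℕ} {U : Type*} [Fintype U] [DecidableEq U]

/-- The probability, under the block law `Q`, of the first `τ` letters of `a`. -/
def prefixMass (Q : (Fin ℓ → U) → ℝ) (τ : ℕ) (a : Fin ℓ → U) : ℝ :=
  ∑ b with ∀ j : Fin ℓ, (j : ℕ) < τ → b j = a j, Q b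

/-- The state of the block automaton is the position in the block, together with a block whose
letters before this position are those read so far. -/
def blockNext (s : Fin ℓ × (Fin ℓ → U)) (x : U) : Fin ℓ × (Fin ℓ → U) :=
  (if h : (s.1 : ℕ) + 1 < ℓ then ⟨s.1 + 1, h⟩ else ⟨0, s.1.pos⟩, Function.update s.2 s.1 x)

/-- The conditional probability of the next letter in the block; the last letter of a block has an
additional factor `1 / 2`. -/
noncomputable def blockWeight (Q : (Fin ℓ → U) → ℝ) (s : Fin ℓ × (Fin ℓ → U)) (x : U) : ℝ :=
  prefixMass Q (s.1 + 1) (Function.update s.2 s.1 x) / prefixMass Q s.1 s.2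
    * if (s.1 : ℕ) + 1 < ℓ then 1 else 1 / 2

variable {Q : (Fin ℓ → U) → ℝ}

lemma prefixMass_nonneg (hQ : ∀ b, 0 ≤ Q b) (τ : ℕ) (a : Fin ℓ → U) : 0 ≤ prefixMass Q τ a :=
  Finset.sum_nonneg fun b _ => hQ b

lemma prefixMass_congr {τ : ℕ} {a b : Fin ℓ → U} (h : ∀ j : Fin ℓ, (j : ℕ) < τ → a j = b j) :
    prefixMass Q τ a = prefixMass Q τ b := by
  unfold prefixMass
  congr 1
  ext c
  simp only [Finset.mem_filter, Finset.mem_univ, true_and]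
  exact forall₂_congr fun j hj => by rw [h j hj]

lemma le_prefixMass (hQ : ∀ b, 0 ≤ Q b) (τ : ℕ) (b : Fin ℓ → U) : Q b ≤ prefixMass Q τ b :=
  Finset.single_le_sum (f := Q) (fun b _ => hQ b) (by simp)

lemma prefixMass_zero (a : Fin ℓ → U) : prefixMass Q 0 a = ∑ b, Q b := by
  simp [prefixMass]

lemma prefixMass_length (b : Fin ℓ → U) : prefixMass Q ℓ b = Q b := by
  have : (Finset.univ.filter fun c : Fin ℓ → U => ∀ j : Fin ℓ, (j : ℕ) < ℓ → c j = b j) = {b} := by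
    ext c
    simp [funext_iff]
  rw [prefixMass, this, Finset.sum_singleton]

lemma sum_prefixMass_update (τ : Fin ℓ) (a : Fin ℓ → U) :
    ∑ x, prefixMass Q (τ + 1) (Function.update a τ x) = prefixMass Q τ a := by
  rw [prefixMass, ← Finset.sum_fiberwise (g := fun b : Fin ℓ → U => b τ)]
  refine Finset.sum_congr rfl fun x _ => Finset.sum_congr ?_ fun _ _ => rfl
  ext b
  simp only [Finset.mem_filter, Finset.mem_univ, true_and]
  constructor
  · intro h
    refine ⟨fun j hj => ?_, ?_⟩
    · rw [h j (by omega), Function.update_of_ne (by rintro rfl; omega)]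
    · rw [h τ (by omega), Function.update_self]
  · rintro ⟨h, rfl⟩ j hj
    by_cases hjt : j = τ
    · subst hjt
      simp
    · rw [Function.update_of_ne hjt]
      refine h j ?_
      have : (j : ℕ) ≠ τ := fun e => hjt (Fin.ext e)
      omega

lemma blockWeight_nonneg (hQ : ∀ b, 0 ≤ Q b) (s : Fin ℓ × (Fin ℓ → U)) (x : U) :
    0 ≤ blockWeight Q s x := by
  refine mul_nonneg (div_nonneg (prefixMass_nonneg hQ _ _) (prefixMass_nonneg hQ _ _)) ?_
  split_ifs <;> norm_num

lemma sum_blockWeight_le (s : Fin ℓ × (Fin ℓ → U)) :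
    ∑ x, blockWeight Q s x ≤ if (s.1 : ℕ) + 1 < ℓ then 1 else 1 / 2 := by
  unfold blockWeight
  rw [← Finset.sum_mul, ← Finset.sum_div, sum_prefixMass_update]
  exact mul_le_of_le_one_left (by split_ifs <;> norm_num) (div_self_le_one _)

lemma blockWeight_le_one (hQ : ∀ b, 0 ≤ Q b) (s : Fin ℓ × (Fin ℓ → U)) (x : U) :
    blockWeight Q s x ≤ 1 := by
  refine (Finset.single_le_sum (fun x _ => blockWeight_nonneg hQ s x) (Finset.mem_univ x)).trans
    ((sum_blockWeight_le s).trans ?_)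
  split_ifs <;> norm_num

/-- The potential falls by 1 per letter, which pays for one word length. At the end of a block it
returns to 2ℓ, and the factor 1/2 pays: 1 + (2ℓ)/2 = 2ℓ - (ℓ - 1). Without that factor each word
length could carry weight 1 and the sum would be unbounded. -/
lemma blockWeight_potential (s : Fin ℓ × (Fin ℓ → U)) :
    1 + ∑ x, blockWeight Q s x * (2 * ℓ - ((blockNext s x).1 : ℕ)) ≤ 2 * (ℓ : ℝ) - (s.1 : ℕ) := by
  have hs := sum_blockWeight_le (Q := Q) s
  have hlt : ((s.1 : ℕ) : ℝ) + 1 ≤ ℓ := by exact_mod_cast s.1.2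
  by_cases h : (s.1 : ℕ) + 1 < ℓ
  · simp only [blockNext, dif_pos h, if_pos h, ← Finset.sum_mul] at hs ⊢
    push_cast
    nlinarith
  · have heq : ((s.1 : ℕ) : ℝ) + 1 = ℓ := by
      have := s.1.2
      exact_mod_cast (by omega : (s.1 : ℕ) + 1 = ℓ)
    simp only [blockNext, dif_neg h, if_neg h, ← Finset.sum_mul] at hs ⊢
    push_cast
    nlinarith

/-- The weight of the rest of a block, and the state after it. -/
lemma weight_drop_block (hQ : ∀ b, 0 ≤ Q b) {b : Fin ℓ → U} (hb : 0 < Q b) (m : ℕ) :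
    ∀ (τ : Fin ℓ) (a : Fin ℓ → U), (τ : ℕ) + m + 1 = ℓ →
      (∀ j : Fin ℓ, (j : ℕ) < τ → a j = b j) →
      weight blockNext (blockWeight Q) (τ, a) ((List.ofFn b).drop τ)
          = Q b / 2 / prefixMass Q τ b ∧
        ((List.ofFn b).drop τ).foldl blockNext (τ, a) = (⟨0, τ.pos⟩, b) := by
  induction m with
  | zero =>
    intro τ a hτ hab
    have hupd : Function.update a τ (b τ) = b := by
      ext j
      by_cases hj : j = τ
      · subst hj; simp
      · rw [Function.update_of_ne hj]
        have : (j : ℕ) ≠ τ := fun e => hj (Fin.ext e)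
        exact hab j (by omega)
    have hnot : ¬ (τ : ℕ) + 1 < ℓ := by omega
    have hdrop : (List.ofFn b).drop τ = [b τ] := by
      rw [List.drop_eq_getElem_cons (by simp), List.drop_of_length_le (by simp; omega)]
      simp
    rw [hdrop]
    constructor
    · simp only [weight, blockWeight, hupd, if_neg hnot, mul_one]
      have : (τ : ℕ) + 1 = ℓ := by omega
      rw [this, prefixMass_length, prefixMass_congr hab]
      ring
    · simp [blockNext, hnot, hupd]
  | succ m ih =>
    intro τ a hτ hab
    have hlt : (τ : ℕ) + 1 < ℓ := by omega
    have hupd : ∀ j : Fin ℓ, (j : ℕ) < τ + 1 → Function.update a τ (b τ) j = b j := by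
      intro j hjlt
      by_cases hj : j = τ
      · subst hj; simp
      · rw [Function.update_of_ne hj]
        have : (j : ℕ) ≠ τ := fun e => hj (Fin.ext e)
        exact hab j (by omega)
    have hdrop : (List.ofFn b).drop τ = b τ :: (List.ofFn b).drop (τ + 1) := by
      rw [List.drop_eq_getElem_cons (by simp)]
      simp
    obtain ⟨h1, h2⟩ := ih ⟨τ + 1, hlt⟩ (Function.update a τ (b τ)) (by simp; omega) hupd
    have hnext : blockNext (τ, a) (b τ) = (⟨τ + 1, hlt⟩, Function.update a τ (b τ)) := by
      simp [blockNext, hlt]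
    rw [hdrop]
    constructor
    · rw [weight, hnext, h1, blockWeight, if_pos hlt]
      simp only
      rw [prefixMass_congr hupd, prefixMass_congr hab]
      have p1 := hb.trans_le (le_prefixMass hQ (τ + 1) b)
      have p2 := hb.trans_le (le_prefixMass hQ τ b)
      field_simp
    · rw [List.foldl_cons, hnext, h2]

/-- The weight of a concatenation of blocks. -/
lemma weight_blocks (hQ : Q ∈ stdSimplex ℝ (Fin ℓ → U)) (hℓ : 0 < ℓ) (L : List (Fin ℓ → U))
    (hL : ∀ b ∈ L, 0 < Q b) (a : Fin ℓ → U) :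
    weight blockNext (blockWeight Q) (⟨0, hℓ⟩, a) (L.map List.ofFn).flatten
      = (L.map fun b => Q b / 2).prod := by
  induction L generalizing a with
  | nil => simp [weight]
  | cons b L ih =>
    obtain ⟨h1, h2⟩ := weight_drop_block hQ.1 (hL b (by simp)) (ℓ - 1) ⟨0, hℓ⟩ a
      (by simp; omega) (by simp)
    simp only [List.drop_zero, prefixMass_zero, hQ.2, div_one] at h1 h2
    rw [List.map_cons, List.flatten_cons, weight_append, h1, h2, List.map_cons, List.prod_cons,
      ih fun b hb => hL b (by simp [hb])]

/-- A lower bound, in terms of the number of phrases, for the ideal code length of the blocks of a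
sequence under a block law `Q`. -/
lemma lzCount_mul_log_le [Nonempty U] {k : ℕ} (hℓ : 0 < ℓ) (hk : 0 < k)
    (hQ : Q ∈ stdSimplex ℝ (Fin ℓ → U))
    (u : Fin (k * ℓ) → U) (hu : ∀ i, 0 < Q (block u i)) :
    (lzCount u : ℝ) * Real.logb 2 (lzCount u)
      ≤ -∑ i, Real.logb 2 (Q (block u i)) + k
        + lzCount u * Real.logb 2 (2 * ℓ ^ 2 * (Fintype.card U : ℝ) ^ ℓ + 1) := by
  obtain ⟨new, last, h1, h2, h3, h4, -⟩ := lzParse_spec (List.ofFn u)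
  obtain ⟨a⟩ : Nonempty (Fin ℓ → U) := inferInstance
  set s : Fin ℓ × (Fin ℓ → U) := (⟨0, hℓ⟩, a) with hs
  set pw := phraseWeights blockNext (blockWeight Q) s (new ++ last) with hpw
  have hc : pw.length = lzCount u := by rw [hpw, length_phraseWeights, lzCount, h1]
  have hflat : List.ofFn u = ((List.ofFn (block u)).map List.ofFn).flatten := by
    rw [List.ofFn_mul, List.map_ofFn]
    congr 2
    ext i : 1
    congr 1
    ext j
    unfold block
    congr 1
    apply Fin.ext
    simp [finProdFinEquiv_apply_val, mul_comm, add_comm]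
  have hprod : pw.prod = ∏ i, (Q (block u i) / 2) := by
    rw [hpw, prod_phraseWeights, h4, hflat, hs,
      weight_blocks hQ hℓ _ (by simpa [List.mem_ofFn] using hu), List.map_ofFn, List.prod_ofFn]
    rfl
  have hpos : 0 < pw.prod := by
    rw [hprod]
    exact Finset.prod_pos fun i _ => half_pos (hu i)
  -- A zero weight would make the whole product vanish.
  have hpwpos : ∀ r ∈ pw, 0 < r := by
    intro r hr
    refine (phraseWeights_nonneg (blockWeight_nonneg hQ.1) s _ r hr).lt_of_ne ?_
    rintro rfl
    exact hpos.ne' (List.prod_eq_zero hr)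
  have hsum : pw.sum ≤ 2 * ℓ ^ 2 * (Fintype.card U : ℝ) ^ ℓ + 1 := by
    refine (sum_phraseWeights_le (B := fun s => 2 * (ℓ : ℝ) - (s.1 : ℕ))
      (blockWeight_nonneg hQ.1) (blockWeight_le_one hQ.1) ?_
      blockWeight_potential h2 h3 s).trans (add_le_add_left ?_ _)
    · intro s
      have hlt : ((s.1 : ℕ) : ℝ) + 1 ≤ ℓ := by exact_mod_cast s.1.2
      linarith [(Nat.cast_nonneg (s.1 : ℕ) : (0 : ℝ) ≤ _)]
    · refine (Finset.sum_le_sum fun s _ => (sub_le_self (2 * (ℓ : ℝ))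
        (Nat.cast_nonneg (s.1 : ℕ)))).trans_eq ?_
      simp
      ring
  have hlen : 0 < pw.length := by
    rw [hc]
    exact lzCount_pos (Nat.mul_pos hk hℓ) u
  have hJ := length_mul_logb_le pw hpwpos hlen (by positivity) hsum
  have hlog : Real.logb 2 pw.prod = ∑ i, Real.logb 2 (Q (block u i)) - k := by
    rw [hprod, Real.logb_prod _ _ fun i _ => (half_pos (hu i)).ne']
    have : ∀ i, Real.logb 2 (Q (block u i) / 2) = Real.logb 2 (Q (block u i)) - 1 := by
      intro i
      rw [Real.logb_div (hu i).ne' two_ne_zero, Real.logb_self_eq_one (by norm_num)]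
    simp [this]
  rw [hlog, hc] at hJ
  linarith

variable {Y : Type*} [Fintype Y]

/-- The Lempel–Ziv lower bound for the empirical entropy of blocks. -/
lemma lzCount_mul_log_le_entropy [Nonempty U] {k : ℕ} (hℓ : 0 < ℓ) (hk : 0 < k)
    {p : Fin (k * ℓ) → Y → ℝ} (hp : ∀ t, p t ∈ stdSimplex ℝ Y) (u : Fin (k * ℓ) → U) :
    (lzCount u : ℝ) * Real.logb 2 (lzCount u)
      ≤ k * rvEntropy (blockLaw k ℓ p) (fun ω => block u ω.1) + k
        + lzCount u * Real.logb 2 (2 * ℓ ^ 2 * (Fintype.card U : ℝ) ^ ℓ + 1) := by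
  classical
  have hμ := blockLaw_mem_stdSimplex (ℓ := ℓ) hk hp
  have hk' : (0 : ℝ) < k := by exact_mod_cast hk
  -- For the empirical law of the blocks, the ideal code length is exactly `k` times the block
  -- entropy.
  have h := lzCount_mul_log_le hℓ hk (mass_mem_stdSimplex hμ fun ω => block u ω.1) u ?_
  · have hE : k * rvEntropy (blockLaw k ℓ p) (fun ω => block u ω.1)
        = -∑ i, Real.logb 2 (mass (blockLaw k ℓ p) (fun ω => block u ω.1) (block u i)) := by
      rw [rvEntropy, sum_blockLaw_mul fun i _ =>
        Real.logb 2 (mass (blockLaw k ℓ p) (fun ω => block u ω.1) (block u i))]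
      simp only [← Finset.sum_mul, sum_prod_eq_one hp, one_mul]
      field_simp
    rwa [hE]
  · intro i
    have h1 : (0 : ℝ) < (k : ℝ)⁻¹ := by positivity
    rw [← mass_index hp i] at h1
    refine h1.trans_le (Finset.sum_le_sum_of_subset_of_nonneg ?_ fun ω _ _ => hμ.1 ω)
    intro ω hω
    simp only [Finset.mem_filter, Finset.mem_univ, true_and] at hω ⊢
    rw [hω]

end BlockAutomaton

/-! ### Explicit growth bounds -/

section Asymptotics

lemma one_le_one_add_logb (J : ℕ) : 1 ≤ 1 + Real.logb 2 J := by
  rcases Nat.eq_zero_or_pos J with rfl | hJ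
  · simp
  · have : 0 ≤ Real.logb 2 J := Real.logb_nonneg (by norm_num) (by exact_mod_cast hJ)
    linarith

lemma exists_logb_bounds (a : ℝ) : ∃ N : ℕ, ∀ n : ℕ, N ≤ n →
    100 * a ≤ Real.logb 2 n ∧ Real.logb 2 n ≤ 0.02 * (n : ℝ) ^ (0.1 : ℝ) := by
  have h1 : ∀ᶠ n : ℕ in Filter.atTop, 100 * a ≤ Real.logb 2 n :=
    ((Real.tendsto_logb_atTop (by norm_num)).comp tendsto_natCast_atTop_atTop).eventually_ge_atTop _
  have hlog2 : 0 < Real.log 2 := Real.log_pos (by norm_num)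
  have h2 : ∀ᶠ n : ℕ in Filter.atTop, Real.logb 2 n ≤ 0.02 * (n : ℝ) ^ (0.1 : ℝ) := by
    have ho := (isLittleO_log_rpow_atTop (r := 0.1) (by norm_num)).bound
      (c := 0.02 * Real.log 2) (by positivity)
    filter_upwards [tendsto_natCast_atTop_atTop.eventually ho] with n hn
    rw [Real.norm_eq_abs, Real.norm_of_nonneg (Real.rpow_nonneg (Nat.cast_nonneg n) _)] at hn
    rw [Real.logb, div_le_iff₀ hlog2]
    linarith [le_abs_self (Real.log n)]
  exact Filter.eventually_atTop.1 (h1.and h2)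

lemma lzCount_mul_logb_le {U : Type*} [Fintype U] [Nonempty U] [DecidableEq U] {n : ℕ}
    (hn : 0 < n) (u : Fin n → U)
    (h1 : 100 * (1 + Real.logb 2 (Fintype.card U)) ≤ Real.logb 2 n)
    (h2 : Real.logb 2 n ≤ 0.02 * (n : ℝ) ^ (0.1 : ℝ)) :
    lzCount u * Real.logb 2 n ≤ 1.2 * (1 + Real.logb 2 (Fintype.card U)) * n := by
  set a := 1 + Real.logb 2 (Fintype.card U) with ha
  have ha1 : 1 ≤ a := one_le_one_add_logb _
  have hn' : (1 : ℝ) ≤ n := by exact_mod_cast hn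
  have hJ : (1 : ℝ) ≤ Fintype.card U := by exact_mod_cast Fintype.card_pos
  set lg := Real.logb 2 n with hlg
  have hlgpos : 0 < lg := by linarith
  -- Since J + 1 ≤ 2J = 2^a, this length threshold leaves at most n^0.9 short words, while there are
  -- at most n/m ≤ 1.13 a n / log n long phrases.
  set m := ⌊0.9 * lg / a⌋₊ with hm
  have hm1 : (m : ℝ) ≤ 0.9 * lg / a := Nat.floor_le (by positivity)
  have hm2 : 0.9 * lg / a - 1 < m := Nat.sub_one_lt_floor _
  have hm3 : 0.89 * lg / a ≤ m := by
    have : 1 ≤ 0.01 * lg / a := by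
      rw [le_div_iff₀ (by positivity)]
      linarith
    have e : 0.9 * lg / a = 0.89 * lg / a + 0.01 * lg / a := by ring
    linarith
  have hmpos : 0 < m := by
    have : 0 < (m : ℝ) := lt_of_lt_of_le (by positivity) hm3
    exact_mod_cast this
  have hc := lzCount_le_of_length u hmpos
  have hlong : (n : ℝ) / m * lg ≤ 1.13 * a * n := by
    have hmr : (0 : ℝ) < m := by exact_mod_cast hmpos
    rw [div_mul_eq_mul_div, div_le_iff₀ hmr]
    have : 0.89 * lg ≤ m * a := by rwa [div_le_iff₀ (by positivity)] at hm3
    nlinarith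
  have hshort : ((Fintype.card U : ℝ) + 1) ^ m ≤ (n : ℝ) ^ (0.9 : ℝ) := by
    have e1 : (2 : ℝ) ^ a = 2 * Fintype.card U := by
      rw [ha, Real.rpow_add (by norm_num), Real.rpow_one,
        Real.rpow_logb (by norm_num) (by norm_num) (by linarith)]
    calc ((Fintype.card U : ℝ) + 1) ^ m ≤ ((2 : ℝ) ^ a) ^ m := by
          rw [e1]
          gcongr
          linarith
      _ = (2 : ℝ) ^ (a * m) := by rw [Real.rpow_mul (by norm_num), Real.rpow_natCast]
      _ ≤ (2 : ℝ) ^ (lg * 0.9) := by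
          refine Real.rpow_le_rpow_of_exponent_le (by norm_num) ?_
          have := (le_div_iff₀ (by positivity : 0 < a)).1 hm1
          linarith
      _ = (n : ℝ) ^ (0.9 : ℝ) := by
          rw [Real.rpow_mul (by norm_num), hlg,
            Real.rpow_logb (by norm_num) (by norm_num) (by linarith)]
  have e2 : (n : ℝ) ^ (0.9 : ℝ) * (n : ℝ) ^ (0.1 : ℝ) = n := by
    rw [← Real.rpow_add (by linarith)]
    norm_num
  have e3 : (n : ℝ) ^ (0.1 : ℝ) ≤ n := by
    simpa using Real.rpow_le_rpow_of_exponent_le hn' (by norm_num : (0.1 : ℝ) ≤ 1)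
  have e4 : (n : ℝ) ^ (0.9 : ℝ) * lg ≤ 0.02 * n := by
    have := mul_le_mul_of_nonneg_left h2 (Real.rpow_nonneg (by linarith : (0 : ℝ) ≤ n) 0.9)
    linarith
  calc lzCount u * lg ≤ ((n : ℝ) / m + ((Fintype.card U : ℝ) + 1) ^ m + 1) * lg := by gcongr
    _ = (n : ℝ) / m * lg + ((Fintype.card U : ℝ) + 1) ^ m * lg + lg := by ring
    _ ≤ 1.13 * a * n + (n : ℝ) ^ (0.9 : ℝ) * lg + lg := by gcongr
    _ ≤ 1.2 * a * n := by nlinarith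

lemma two_mul_sq_add_one_le (ℓ : ℕ) : 2 * (ℓ : ℝ) ^ 2 + 1 ≤ 3 ^ ℓ := by
  match ℓ with
  | 0 => norm_num
  | 1 => norm_num
  | m + 2 =>
    induction m with
    | zero => norm_num
    | succ m ih =>
      rw [show m + 1 + 2 = m + 2 + 1 from rfl, pow_succ (3 : ℝ)]
      push_cast at ih ⊢
      nlinarith [(Nat.cast_nonneg m : (0 : ℝ) ≤ m)]

lemma logb_context_count_le {J ℓ : ℕ} (hJ : 0 < J) :
    Real.logb 2 (2 * ℓ ^ 2 * (J : ℝ) ^ ℓ + 1) ≤ ℓ * (1.6 * (1 + Real.logb 2 J)) := by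
  have hJ' : (1 : ℝ) ≤ J := by exact_mod_cast hJ
  have h1 : 2 * (ℓ : ℝ) ^ 2 * (J : ℝ) ^ ℓ + 1 ≤ (3 * J) ^ ℓ := by
    have := mul_le_mul_of_nonneg_right (two_mul_sq_add_one_le ℓ) (by positivity : 0 ≤ (J : ℝ) ^ ℓ)
    have h2 : 1 ≤ (J : ℝ) ^ ℓ := one_le_pow₀ hJ'
    rw [mul_pow]
    linarith
  have h3 : Real.logb 2 3 ≤ 1.6 := by
    rw [Real.logb_le_iff_le_rpow (by norm_num) (by norm_num)]
    -- 3^5 = 243 ≤ 256 = 2^8.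
    refine le_of_pow_le_pow_left₀ (n := 5) (by norm_num) (by positivity) ?_
    rw [← Real.rpow_natCast, ← Real.rpow_natCast, ← Real.rpow_mul (by norm_num)]
    norm_num
  refine (Real.logb_le_logb_of_le (by norm_num) (by positivity) h1).trans ?_
  rw [Real.logb_pow, Real.logb_mul (by norm_num) (by positivity)]
  have h4 := one_le_one_add_logb J
  gcongr
  linarith

end Asymptotics

/-! ### The function Ψ and the final assembly -/

section Psi

variable {U : Type*} [Fintype U] {ϱ : U → ℝ}

/-- For `x ≥ 0` the distortion of `q` itself lies in the level set; for `x < 0` nonnegativity of `ϱ`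
suffices, so no entropy bound is needed. -/
lemma psi_le_of_le_entropy (hϱ : ∀ w, 0 ≤ ϱ w) {q : U → ℝ} (hq : q ∈ stdSimplex ℝ U) {x : ℝ}
    (hx : 0 ≤ x → x ≤ entropy q) : psi ϱ x ≤ ((∑ w, q w * ϱ w : ℝ) : EReal) := by
  unfold psi
  split_ifs with h
  · exact_mod_cast Finset.sum_nonneg fun w _ => mul_nonneg (hq.1 w) (hϱ w)
  · refine sInf_le ⟨_, ⟨⟨q, hq, le_rfl⟩, (hx (not_lt.1 h)).trans ?_⟩, rfl⟩
    refine le_csSup ⟨Real.logb 2 (Fintype.card U), ?_⟩ ⟨q, ⟨hq, le_rfl⟩, rfl⟩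
    rintro _ ⟨p, hp, rfl⟩
    exact entropy_le_log_card hp.1

end Psi

lemma delta2_ge {J K L ℓ n : ℕ} {r ε : ℝ} (hε0 : 0 < ε) (hε1 : ε < 1) (hn : 2 ≤ n) :
    r + 2 * ℓ * (1 + Real.logb 2 J) ^ 2 / Real.logb 2 n + 1 / ℓ ≤ delta2 J K L ℓ n r ε := by
  have hlog : ∀ N : ℕ, 0 ≤ Real.logb 2 N := fun N => by linarith [one_le_one_add_logb N]
  have hL := hlog L
  have hJ := hlog J
  have hlogn : 0 < Real.logb 2 n := Real.logb_pos (by norm_num) (by exact_mod_cast hn)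
  have he : 0 ≤ Real.logb 2 (Real.exp 1) :=
    Real.logb_nonneg (by norm_num) (Real.one_le_exp zero_le_one)
  have h1 : 2 * ℓ * (1 + Real.logb 2 J) ^ 2 / Real.logb 2 n
      ≤ 2 * ℓ * (1 + Real.logb 2 J) ^ 2 / ((1 - ε) * Real.logb 2 n) := by
    refine div_le_div_of_nonneg_left (by positivity) (mul_pos (by linarith) hlogn) ?_
    nlinarith
  have h2 : 0 ≤ ((J : ℝ) * K) ^ ℓ * Real.logb 2 L / √(n : ℝ) := by positivity
  have h3 : 0 ≤ ((J : ℝ) * K * L) ^ ℓ * Real.logb 2 (Real.exp 1) / (2 * n) := by positivity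
  have h4 : 0 ≤ 2 * ℓ * (J : ℝ) ^ (2 * ℓ) * Real.logb 2 J / n := by positivity
  unfold delta2 delta1
  linarith

end SemiDet

theorem theorem2 (J : ℕ) :
    ∃ ε : ℕ → ℝ, (∀ n, 0 < ε n ∧ ε n < 1) ∧
      Filter.Tendsto ε Filter.atTop (nhds 0) ∧
      ∀ K L ℓ : ℕ, 0 < ℓ →
        ∃ r : ℕ → ℝ,
          Asymptotics.IsLittleO Filter.atTop r (fun n : ℕ => 1 / √(n : ℝ)) ∧
          ∀ (U X Y Z : Type*) [AddGroup U] [DecidableEq U] [Fintype U] [Fintype X] [Fintype Y]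
            [Fintype Z],
            Fintype.card U = J → Fintype.card X = K → Fintype.card Y = L →
            ∀ (ϱ : U → ℝ), (∀ w, 0 ≤ ϱ w) →
            ∀ (P : X → Y → ℝ), SemiDet.IsChannel P →
            ∀ n : ℕ, 2 ≤ n → ℓ ∣ n →
            ∀ (u : Fin n → U) (enc : (Fin n → U) → Fin n → X)
              (d : ℕ) (D : SemiDet.Decoder Z Y U) (tail : (Fin n → Y) → Fin n → U),
              SemiDet.psi ϱ
                  ((SemiDet.lzCount u : ℝ) * Real.logb 2 (SemiDet.lzCount u) / n
                    - SemiDet.capacity P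
                    - (2 * Real.logb 2 (Fintype.card Z) + d * Real.logb 2 (Fintype.card U)) / ℓ
                    - SemiDet.delta2 J K L ℓ n (r n) (ε n))
                ≤ (((1 / (n : ℝ)) * ∑ t : Fin n,
                    SemiDet.expect P (enc u)
                      (fun y => ϱ (D.recon ℓ d tail y t - u t)) : ℝ) : EReal) := by
  obtain ⟨N, hN⟩ := SemiDet.exists_logb_bounds (1 + Real.logb 2 J)
  have hε : ∀ n : ℕ, 0 < 1 / ((n : ℝ) + 2) ∧ 1 / ((n : ℝ) + 2) < 1 := fun n => by
    refine ⟨by positivity, ?_⟩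
    rw [div_lt_one (by positivity)]
    linarith [(Nat.cast_nonneg n : (0 : ℝ) ≤ n)]
  refine ⟨fun n => 1 / ((n : ℝ) + 2), hε, ?_, ?_⟩
  · simp only [one_div]
    exact tendsto_inv_atTop_zero.comp
      (Filter.tendsto_atTop_add_const_right _ _ tendsto_natCast_atTop_atTop)
  intro K L ℓ hℓ
  -- Eventually zero, hence o(1/√n). Below `N` it exceeds c log c / n ≤ log n, which makes the
  -- argument of Ψ negative.
  refine ⟨fun n => if n < N then Real.logb 2 n + 1 else 0, ?_, ?_⟩
  · refine (Asymptotics.isLittleO_zero _ _).congr' ?_ Filter.EventuallyEq.rfl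
    filter_upwards [Filter.eventually_ge_atTop N] with n hn
    rw [if_neg (not_lt.2 hn)]
  intro U X Y Z _ _ _ _ _ _ hU _ _ ϱ hϱ P hP n hn hdvd u enc d D tail
  obtain ⟨k, rfl⟩ := exists_eq_mul_left_of_dvd hdvd
  have hk : 0 < k := Nat.pos_of_ne_zero (by rintro rfl; simp at hn)
  have hJ : 0 < J := hU ▸ Fintype.card_pos
  have : Nonempty X := ⟨enc u ⟨0, by omega⟩⟩
  have : Nonempty Z := ⟨D.init⟩
  have hs : 0 ≤ Real.logb 2 (Fintype.card Z) := by
    linarith [SemiDet.one_le_one_add_logb (Fintype.card Z)]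
  have hC := SemiDet.capacity_nonneg hP
  obtain ⟨q, hq, hdist, hH⟩ := SemiDet.exists_error_law hk hℓ hP u (enc u) d D tail ϱ
  rw [← hdist]
  refine SemiDet.psi_le_of_le_entropy hϱ hq fun hx => ?_
  have hδ := SemiDet.delta2_ge (J := J) (K := K) (L := L) (ℓ := ℓ)
    (r := if k * ℓ < N then Real.logb 2 ((k * ℓ : ℕ) : ℝ) + 1 else 0) (hε (k * ℓ)).1 (hε _).2 hn
  dsimp only at hx ⊢
  set n : ℝ := ((k * ℓ : ℕ) : ℝ) with hndef
  set c := SemiDet.lzCount u with hcdef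
  have hn0 : 0 < n := Nat.cast_pos.2 (by omega)
  have hℓ0 : (0 : ℝ) < ℓ := by exact_mod_cast hℓ
  have hk0 : (0 : ℝ) < k := by exact_mod_cast hk
  have hlogn : 0 < Real.logb 2 n := Real.logb_pos (by norm_num) (Nat.one_lt_cast.2 (by omega))
  have hd : 0 ≤ d * Real.logb 2 (Fintype.card U) := by
    have := SemiDet.one_le_one_add_logb (Fintype.card U)
    exact mul_nonneg (Nat.cast_nonneg d) (by linarith)
  have ha := SemiDet.one_le_one_add_logb J
  by_cases hnN : k * ℓ < N
  · exfalso
    have hc : (c : ℝ) * Real.logb 2 c / n ≤ Real.logb 2 n := by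
      have h1 : (c : ℝ) ≤ n := Nat.cast_le.2 (SemiDet.lzCount_le u)
      have h2 : (0 : ℝ) < c := by exact_mod_cast SemiDet.lzCount_pos (by omega) u
      rw [div_le_iff₀ hn0, mul_comm]
      gcongr
      norm_num
    rw [if_pos hnN] at hδ hx
    have h3 : 0 ≤ 2 * ℓ * (1 + Real.logb 2 J) ^ 2 / Real.logb 2 n := by positivity
    have h4 : 0 ≤ (2 * Real.logb 2 (Fintype.card Z) + d * Real.logb 2 (Fintype.card U)) / ℓ := by
      positivity
    have h5 : (0 : ℝ) ≤ 1 / ℓ := by positivity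
    linarith
  · rw [if_neg hnN] at hδ ⊢
    obtain ⟨hb1, hb2⟩ := hN (k * ℓ) (not_lt.1 hnN)
    rw [← hU] at hb1
    have hcount := SemiDet.lzCount_mul_logb_le (by omega) u hb1 hb2
    have hLZ := SemiDet.lzCount_mul_log_le_entropy hℓ hk (fun t => hP (enc u t)) u
    have hctx := SemiDet.logb_context_count_le (ℓ := ℓ) hJ
    rw [hU] at hcount hLZ hH ⊢
    rw [← hcdef] at hcount hLZ
    set a := 1 + Real.logb 2 J with hadef
    set H := SemiDet.rvEntropy (SemiDet.blockLaw k ℓ fun t => P (enc u t))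
      (fun ω => SemiDet.block u ω.1)
    have hnk : n = k * ℓ := by rw [hndef]; push_cast; rfl
    have hc1 : c / n ≤ 1.2 * a / Real.logb 2 n := by
      rw [div_le_div_iff₀ hn0 hlogn]
      exact hcount
    -- The constants of the two growth bounds multiply to 1.2 · 1.6 = 1.92, within the 2 allowed by
    -- δ₂.
    have hc2 : c / n * Real.logb 2 (2 * ℓ ^ 2 * (J : ℝ) ^ ℓ + 1)
        ≤ 2 * ℓ * a ^ 2 / Real.logb 2 n := by
      calc _ ≤ c / n * (ℓ * (1.6 * a)) := by gcongr
        _ ≤ 1.2 * a / Real.logb 2 n * (ℓ * (1.6 * a)) := by gcongr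
        _ = 1.92 * (ℓ * a ^ 2 / Real.logb 2 n) := by ring
        _ ≤ 2 * (ℓ * a ^ 2 / Real.logb 2 n) := by gcongr; norm_num
        _ = _ := by ring
    have hLZ' : (c : ℝ) * Real.logb 2 c / n
        ≤ H / ℓ + 1 / ℓ + c / n * Real.logb 2 (2 * ℓ ^ 2 * (J : ℝ) ^ ℓ + 1) := by
      refine (div_le_div_of_nonneg_right hLZ hn0.le).trans_eq ?_
      rw [hnk]
      field_simp
    have hH' : H / ℓ ≤ SemiDet.entropy q + SemiDet.capacity P
        + (Real.logb 2 (Fintype.card Z) + d * Real.logb 2 J) / ℓ := by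
      refine (div_le_div_of_nonneg_right hH hℓ0.le).trans_eq ?_
      field_simp
      ring
    have hs2 : (Real.logb 2 (Fintype.card Z) + d * Real.logb 2 J) / ℓ
        ≤ (2 * Real.logb 2 (Fintype.card Z) + d * Real.logb 2 J) / ℓ := by
      gcongr
      linarith
    linarith
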